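/- Notation. For positive integers $a_i$ write $[a_1,a_2,\dots]=\cfrac{1}{a_1+\cfrac{1}{a_2+\cdots}}$, with a bar over a period. For $x\ge 0$ let $\gamma(x)$ be the path to $x$ in the Farey tree: start from the neighbours $\frac01,\frac10$ and at each step replace the current Farey interval by that half, cut at the mediant $\frac{a+c}{b+d}$ of its endpoints $\frac ab,\frac cd$, which contains $x$. Let $w_n(x)$ be the denominator of the mediant at the $n$-th step (the largest number of the $n$-th triple $u+v=w$ of the Euclid tree), and let $\Lambda(x)=\limsup_{n\to\infty}\frac{\ln w_n(x)}{n}$, with $\Lambda(-x)=\Lambda(x)$. For rational $\frac pq\in[0,\frac12]$ (in lowest terms) define the Markov number $m(\frac pq)$ and the Markov–Hurwitz number $x(\frac pq)$ along the Farey tree that starts from $\frac01,\frac12$: $m(\frac01)=1$, $m(\frac12)=2$, $m(\frac13)=5$, and further Markov numbers are produced by the Vieta involution $(k,l,m)\mapsto(k,l,3kl-m)$ on the triple of Markov numbers attached to two Farey neighbours and their mediant; $x(\frac pq)=[\overline{w(p/q)}]$, where $w(\frac01)=1,1$, $w(\frac12)=2,2$, and the period of the mediant of Farey neighbours $\frac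 ab<\frac cd$ is the concatenation of $w(\frac cd)$ followed by $w(\frac ab)$. Let $\mathbb X$ be the set of all $x(\frac pq)$, $\frac pq\in[0,\frac12]\cap\mathbb Q$; the number $x(\frac pq)$ is also denoted $x_m$ with $m=m(\frac pq)$. Fock's function is $\psi(\frac pq)=\frac1q\operatorname{arcosh}\bigl(\frac32 m(\frac pq)\bigr)$. Theorem. For every $\frac pq\in[0,\frac12]\cap\mathbb Q$ in lowest terms, $$\Lambda\bigl(x(\tfrac pq)\bigr)=\frac{1}{2q}\operatorname{arcosh}\Bigl(\frac{3\,m(p/q)}{2}\Bigr)=\frac12\,\psi\bigl(\tfrac pq\bigr),$$ and $\Lambda(x(\frac pq))$ is a convex function of $\frac pq\in[0,\frac12]\cap\mathbb Q$. The restriction of $\Lambda$ to $\mathbb X$ is strictly increasing, from $\Lambda(x_2)=\frac12\ln(1+\sqrt2)$ at the least element $x_2=x(\frac12)=\sqrt2-1$ of $\mathbb X$ to $\Lambda(x_1)=\ln\frac{1+\sqrt5}{2}$ at its greatest element $x_1=x(\frac01)=\frac{\sqrt5-1}{2}$. -/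

import Mathlib

namespace MarkovHurwitz

/-! ### The Lyapunov function -/

/-- A position on the positive Farey tree: the Farey interval `[rnum / rden, lnum / lden]` with
neighbouring endpoints. The matrix with rows `(lnum, rnum)` and `(lden, rden)` is the element of
`SL₂(ℕ)` attached to it. -/
structure FareyEdge where
  lnum : ℕ
  rnum : ℕ
  lden : ℕ
  rden : ℕ

/-- The root of the positive Farey tree: the interval from `0/1` to `1/0`. -/
def FareyEdge.root : FareyEdge := ⟨1, 0, 0, 1⟩

open Classical in
/-- One step of the path towards `x ≥ 0`: the interval is cut at the mediant of its endpoints and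
the path enters the half that contains `x`. (At a rational `x` equal to the mediant we enter the
lower half; for rational `x` both continuations have Lyapunov exponent `0`.) -/
noncomputable def FareyEdge.step (x : ℝ) (e : FareyEdge) : FareyEdge :=
  if x ≤ ((e.lnum + e.rnum : ℕ) : ℝ) / ((e.lden + e.rden : ℕ) : ℝ) then
    ⟨e.lnum + e.rnum, e.rnum, e.lden + e.rden, e.rden⟩
  else
    ⟨e.lnum, e.lnum + e.rnum, e.lden, e.lden + e.rden⟩

/-- The path `γ(x)` to `x ≥ 0` in the positive Farey tree. -/
noncomputable def fareyPath (x : ℝ) (n : ℕ) : FareyEdge := (FareyEdge.step x)^[n] FareyEdge.root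

/-- The largest number `w` of the `n`-th triple `(u, v, w)`, `u + v = w`, of the Euclid tree along
the path `γ(x)`; the triple consists of the denominators of the two neighbouring Farey fractions
and of their mediant. -/
noncomputable def euclidMax (x : ℝ) (n : ℕ) : ℕ := (fareyPath x n).lden + (fareyPath x n).rden

/-- The Lyapunov exponent `Λ(x) = limsup (ln w_n(x)) / n`, extended to negative `x` by
`Λ(-x) = Λ(x)`. (The sequence is bounded, since `1 ≤ w_n(x) ≤ 2 ^ n`.) -/
noncomputable def lyapunov (x : ℝ) : ℝ :=
  Filter.limsup (fun n : ℕ => Real.log (euclidMax |x| n : ℝ) / (n : ℝ)) Filter.atTop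

/-! ### Continued fractions -/

/-- The finite continued fraction `[a₁, …, aₖ] = 1 / (a₁ + 1 / (a₂ + ⋯ + 1 / aₖ))`. -/
noncomputable def finContFrac : List ℕ → ℝ
  | [] => 0
  | a :: l => 1 / ((a : ℝ) + finContFrac l)

/-- The infinite continued fraction `[a 0, a 1, a 2, …]` (with positive `a i`), the limit of its
convergents. -/
noncomputable def contFrac (a : ℕ → ℕ) : ℝ :=
  Filter.limUnder Filter.atTop (fun n : ℕ => finContFrac ((List.range n).map a))

/-- The purely periodic continued fraction with the (nonempty) period `w`. -/
noncomputable def periodicContFrac (w : List ℕ) : ℝ :=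
  contFrac (fun k => w.getD (k % w.length) 0)

/-! ### The Farey tree between `0` and `1/2`, the Markov tree and the Markov–Hurwitz tree -/

/-- A vertex of the planar binary tree, where a left, a right and a lower region meet. The left and
right region carry neighbouring Farey fractions `lnum / lden < rnum / rden`, the lower region
carries their mediant. The three regions carry the Markov triple `(lmark, rmark, mark)`. The
left and right region carry periods `lper`, `rper` of continued fractions, and the lower region
carries the conjunction `rper ++ lper`. -/
structure TreeVertex where
  lnum : ℕ
  lden : ℕ
  rnum : ℕ
  rden : ℕ
  lmark : ℤ
  rmark : ℤ
  mark : ℤ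
  lper : List ℕ
  rper : List ℕ

/-- The Farey mediant in the lower region. -/
def TreeVertex.mediant (v : TreeVertex) : ℚ := ((v.lnum + v.rnum : ℕ) : ℚ) / (v.lden + v.rden : ℕ)

/-- The conjunction of the two periods, in the lower region. -/
def TreeVertex.per (v : TreeVertex) : List ℕ := v.rper ++ v.lper

/-- The root: fractions `0/1`, `1/2` (and `1/3`), Markov triple `(1, 2, 5)`, and the periods
`1, 1` and `2, 2` (and `2, 2, 1, 1`). -/
def TreeVertex.root : TreeVertex := ⟨0, 1, 1, 2, 1, 2, 5, [1, 1], [2, 2]⟩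

/-- The lower left neighbour. The new Markov number comes from the Vieta involution
`(x, y, z) ↦ (x, y, 3 x y - z)`. -/
def TreeVertex.left (v : TreeVertex) : TreeVertex :=
  ⟨v.lnum, v.lden, v.lnum + v.rnum, v.lden + v.rden,
    v.lmark, v.mark, 3 * v.lmark * v.mark - v.rmark, v.lper, v.per⟩

/-- The lower right neighbour. -/
def TreeVertex.right (v : TreeVertex) : TreeVertex :=
  ⟨v.lnum + v.rnum, v.lden + v.rden, v.rnum, v.rden,
    v.mark, v.rmark, 3 * v.mark * v.rmark - v.lmark, v.per, v.rper⟩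

/-- One step in the search for the vertex whose mediant is `ξ`; the search stops there. -/
def TreeVertex.step (ξ : ℚ) (v : TreeVertex) : TreeVertex :=
  if ξ < v.mediant then v.left else if v.mediant < ξ then v.right else v

/-- For a rational `0 < ξ < 1/2`, the vertex of the tree with mediant `ξ`. Denominators of mediants
grow by at least one in every step, so it is reached in fewer than `ξ.den` steps. -/
def vertexOf (ξ : ℚ) : TreeVertex := (TreeVertex.step ξ)^[ξ.den] TreeVertex.root

/-- The Markov number `m(ξ)` with Farey parameter `ξ ∈ [0, 1/2] ∩ ℚ`. -/
def markovNumber (ξ : ℚ) : ℤ :=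
  if ξ = 0 then 1 else if ξ = 1 / 2 then 2 else (vertexOf ξ).mark

/-- The period attached to `ξ ∈ [0, 1/2] ∩ ℚ` in the Markov–Hurwitz tree. -/
def hurwitzPeriod (ξ : ℚ) : List ℕ :=
  if ξ = 0 then [1, 1] else if ξ = 1 / 2 then [2, 2] else (vertexOf ξ).per

/-- The Markov–Hurwitz number `x(ξ)` with Farey parameter `ξ ∈ [0, 1/2] ∩ ℚ`. -/
noncomputable def hurwitzNumber (ξ : ℚ) : ℝ := periodicContFrac (hurwitzPeriod ξ)

/-- The set `𝕏` of all Markov–Hurwitz numbers. -/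
def hurwitzSet : Set ℝ := hurwitzNumber '' Set.Icc (0 : ℚ) (1 / 2)

/-- Fock's function `ψ(p/q) = (1/q) arcosh (3 m(p/q) / 2)` on `[0, 1/2] ∩ ℚ`. -/
noncomputable def fock (ξ : ℚ) : ℝ :=
  1 / (ξ.den : ℝ) * Real.arcosh (3 / 2 * (markovNumber ξ : ℝ))

end MarkovHurwitz

namespace MarkovHurwitz

/-! ### Continued fractions with a variable tail -/

/-! The period of `x = x(p/q)` is a word of even length, acting on `[0, 1]` by a Möbius map of
determinant one that fixes `x`. A pair `a, b` of letters is a run of `a` lower and `b` upper steps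
of the Farey path, so the path is self-similar: after as many steps as the letter sum `2q` it sees
the same point again, with the denominator at that point multiplied by the larger eigenvalue `r` of
the matrix of the word. Thus `Λ(x) = ln r / (2q)` (`lyapunov_eq`), and `r + 1/r` is the trace. The
trace is `3m`, because Cayley–Hamilton gives traces of concatenations the recursion that the Vieta
involution gives `3m` (`Good.left`, `Good.right`).

Convexity comes from support lines. For a linear form `L = α q + β p`, both `3m` and `2 cosh L`
satisfy "old + new = product of the two sides" across an edge of the tree. Hence nonnegativity of
the defect `3m - 2 cosh L`, together with its growth in one direction, propagates through the tree
(`le_new_defect`). The Markov equation allows `L` to be chosen with defect zero at a given fraction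
and equal nonnegative defects at its two parents (`exists_symmetric_cosh`); then `L ≤ arcosh (3m/2)`
everywhere, and division by `2q` gives an affine support (`Below.exists_support`).

A horizontal support at `1/2`, strict elsewhere, makes the convex exponent strictly decreasing in
`p/q`. The numbers `x(p/q)` also decrease, since the value of a conjunction lies strictly between
those of its parts (`EvenWord.fixed_append`). So `Λ` increases on `𝕏`. -/

/-- The value `1 / (a₁ + 1 / (a₂ + ⋯ + 1 / (aₖ + y)))`. -/
noncomputable def cfApp (l : List ℕ) (y : ℝ) : ℝ := l.foldr (fun (a : ℕ) (t : ℝ) => 1 / ((a : ℝ) + t)) y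

@[simp] lemma cfApp_nil (y : ℝ) : cfApp [] y = y := rfl

@[simp] lemma cfApp_cons (a : ℕ) (l : List ℕ) (y : ℝ) :
    cfApp (a :: l) y = 1 / ((a : ℝ) + cfApp l y) := rfl

lemma cfApp_append (l₁ l₂ : List ℕ) (y : ℝ) : cfApp (l₁ ++ l₂) y = cfApp l₁ (cfApp l₂ y) := by
  simp [cfApp, List.foldr_append]

lemma finContFrac_eq_cfApp (l : List ℕ) : finContFrac l = cfApp l 0 := by
  induction l with
  | nil => rfl
  | cons a l ih => simp [finContFrac, ih]

lemma cfApp_mem_Icc {l : List ℕ} (hl : ∀ a ∈ l, 0 < a) {y : ℝ} (hy : y ∈ Set.Icc (0 : ℝ) 1) :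
    cfApp l y ∈ Set.Icc (0 : ℝ) 1 := by
  induction l with
  | nil => simpa using hy
  | cons a l ih =>
    obtain ⟨h0, -⟩ := ih (fun b hb => hl b (by simp [hb]))
    have ha : (1 : ℝ) ≤ a := by exact_mod_cast hl a (by simp)
    rw [cfApp_cons]
    refine ⟨by positivity, ?_⟩
    rw [div_le_one (by linarith)]
    linarith

lemma abs_one_div_sub_one_div_le {a b : ℝ} (ha : 1 ≤ a) (hb : 1 ≤ b) :
    |1 / a - 1 / b| ≤ |a - b| := by
  have h : 1 / a - 1 / b = (b - a) / (a * b) := by field_simp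
  rw [h, abs_div, abs_of_pos (by positivity : 0 < a * b), abs_sub_comm]
  exact div_le_self (abs_nonneg _) (by nlinarith)

lemma one_div_add_one_div_add {a b y : ℝ} (h : b + y ≠ 0) :
    1 / (a + 1 / (b + y)) = (b + y) / (a * (b + y) + 1) := by
  rw [show a + 1 / (b + y) = (a * (b + y) + 1) / (b + y) by field_simp, one_div_div]

/-- Two letters give a Möbius map of determinant one, so the difference is divided by a product of
two denominators, each at least `2`. -/
lemma abs_pair_sub_pair_le {a b y z : ℝ} (ha : 1 ≤ a) (hb : 1 ≤ b) (hy : 0 ≤ y) (hz : 0 ≤ z) :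
    |1 / (a + 1 / (b + y)) - 1 / (a + 1 / (b + z))| ≤ 1 / 4 * |y - z| := by
  rw [one_div_add_one_div_add (by positivity), one_div_add_one_div_add (by positivity)]
  have h1 : 2 ≤ a * (b + y) + 1 := by nlinarith
  have h2 : 2 ≤ a * (b + z) + 1 := by nlinarith
  have h : (b + y) / (a * (b + y) + 1) - (b + z) / (a * (b + z) + 1) =
      (y - z) / ((a * (b + y) + 1) * (a * (b + z) + 1)) := by
    field_simp
    ring
  rw [h, abs_div, abs_of_pos (by positivity : 0 < (a * (b + y) + 1) * (a * (b + z) + 1)),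
    div_le_iff₀ (by positivity)]
  nlinarith [abs_nonneg (y - z), mul_le_mul h1 h2 (by norm_num) (by linarith)]

/-- Letters are counted in pairs because a single letter `1` does not contract uniformly near `0`; a
leftover letter does not expand. -/
lemma abs_cfApp_sub_cfApp_le (l : List ℕ) (hl : ∀ a ∈ l, 0 < a) {y z : ℝ}
    (hy : y ∈ Set.Icc (0 : ℝ) 1) (hz : z ∈ Set.Icc (0 : ℝ) 1) :
    |cfApp l y - cfApp l z| ≤ (1 / 4 : ℝ) ^ (l.length / 2) * |y - z| := by
  match l with
  | [] => simp
  | [a] =>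
    have ha : (1 : ℝ) ≤ a := by exact_mod_cast hl a (by simp)
    have := abs_one_div_sub_one_div_le (a := a + y) (b := a + z)
      (by linarith [hy.1]) (by linarith [hz.1])
    simpa using this
  | a :: b :: l =>
    have ha : (1 : ℝ) ≤ a := by exact_mod_cast hl a (by simp)
    have hb : (1 : ℝ) ≤ b := by exact_mod_cast hl b (by simp)
    have hl' : ∀ c ∈ l, 0 < c := fun c hc => hl c (by simp [hc])
    have ih := abs_cfApp_sub_cfApp_le l hl' hy hz
    have h := abs_pair_sub_pair_le ha hb (cfApp_mem_Icc hl' hy).1 (cfApp_mem_Icc hl' hz).1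
    have hlen : (a :: b :: l).length / 2 = l.length / 2 + 1 := by simp; omega
    rw [hlen, pow_succ]
    simp only [cfApp_cons]
    nlinarith

lemma continuousOn_cfApp {l : List ℕ} (hl : ∀ a ∈ l, 0 < a) :
    ContinuousOn (cfApp l) (Set.Icc 0 1) := by
  induction l with
  | nil => exact continuousOn_id
  | cons a l ih =>
    have hl' : ∀ c ∈ l, 0 < c := fun c hc => hl c (by simp [hc])
    have ha : (1 : ℝ) ≤ a := by exact_mod_cast hl a (by simp)
    refine ContinuousOn.div continuousOn_const (continuousOn_const.add (ih hl')) fun y hy => ?_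
    have := (cfApp_mem_Icc hl' hy).1
    change (a : ℝ) + cfApp l y ≠ 0
    linarith

/-- Words of even length with positive letters. -/
inductive EvenWord : List ℕ → Prop
  | nil : EvenWord []
  | cons {a b : ℕ} {l : List ℕ} (ha : 0 < a) (hb : 0 < b) (h : EvenWord l) : EvenWord (a :: b :: l)

/-! ### Even words as increasing contractions and their fixed points. -/

namespace EvenWord

lemma append {l₁ l₂ : List ℕ} (h₁ : EvenWord l₁) (h₂ : EvenWord l₂) : EvenWord (l₁ ++ l₂) := by
  induction h₁ with
  | nil => exact h₂
  | cons ha hb _ ih => exact .cons ha hb ih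

lemma pos {l : List ℕ} (h : EvenWord l) : ∀ a ∈ l, 0 < a := by
  induction h with
  | nil => simp
  | cons ha hb _ ih => simpa using ⟨ha, hb, ih⟩

lemma one_le_half_length {l : List ℕ} (h : EvenWord l) (hne : l ≠ []) : 1 ≤ l.length / 2 := by
  cases h with
  | nil => exact absurd rfl hne
  | cons => simp; omega

lemma sum_pos {l : List ℕ} (h : EvenWord l) (hne : l ≠ []) : 0 < l.sum := by
  cases h with
  | nil => exact absurd rfl hne
  | cons ha => simp; omega

lemma cfApp_strictMono {l : List ℕ} (h : EvenWord l) {y z : ℝ} (hy : y ∈ Set.Icc (0 : ℝ) 1)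
    (hz : z ∈ Set.Icc (0 : ℝ) 1) (hyz : y < z) : cfApp l y < cfApp l z := by
  induction h with
  | nil => simpa using hyz
  | @cons a b l ha hb h ih =>
    have ha : (0 : ℝ) < a := by exact_mod_cast ha
    have hb : (0 : ℝ) < b := by exact_mod_cast hb
    have h1 := (cfApp_mem_Icc h.pos hy).1
    have h2 := (cfApp_mem_Icc h.pos hz).1
    simp only [cfApp_cons]
    gcongr

lemma abs_cfApp_sub_cfApp_lt {l : List ℕ} (h : EvenWord l) (hne : l ≠ []) {y z : ℝ}
    (hy : y ∈ Set.Icc (0 : ℝ) 1) (hz : z ∈ Set.Icc (0 : ℝ) 1) (hyz : y ≠ z) :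
    |cfApp l y - cfApp l z| < |y - z| := by
  refine (abs_cfApp_sub_cfApp_le l h.pos hy hz).trans_lt ?_
  have h1 : 0 < |y - z| := abs_pos.2 (sub_ne_zero.2 hyz)
  have h2 : (1 / 4 : ℝ) ^ (l.length / 2) < 1 :=
    pow_lt_one₀ (by norm_num) (by norm_num) (by have := h.one_le_half_length hne; omega)
  nlinarith

lemma cfApp_mem_Ioo {l : List ℕ} (h : EvenWord l) (hne : l ≠ []) {y : ℝ}
    (hy : y ∈ Set.Icc (0 : ℝ) 1) : cfApp l y ∈ Set.Ioo (0 : ℝ) 1 := by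
  cases h with
  | nil => exact absurd rfl hne
  | @cons a b l ha hb h =>
    have ha : (1 : ℝ) ≤ a := by exact_mod_cast ha
    have hb : (0 : ℝ) < b := by exact_mod_cast hb
    have h1 := (cfApp_mem_Icc h.pos hy).1
    have h2 : 0 < 1 / ((b : ℝ) + cfApp l y) := by positivity
    simp only [cfApp_cons]
    refine ⟨by positivity, ?_⟩
    rw [div_lt_one (by linarith)]
    linarith

lemma exists_fixed {l : List ℕ} (h : EvenWord l) (hne : l ≠ []) :
    ∃ x ∈ Set.Ioo (0 : ℝ) 1, cfApp l x = x := by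
  obtain ⟨x, hx, hfx⟩ := exists_mem_Icc_isFixedPt_of_mapsTo (continuousOn_cfApp h.pos)
    zero_le_one (fun y hy => cfApp_mem_Icc h.pos hy)
  exact ⟨x, by simpa [hfx.eq] using h.cfApp_mem_Ioo hne hx, hfx⟩

/-- A strict contraction brings `y` closer to the fixed point, hence moves it towards that point.
The position of a fixed point can thus be tested at any other point. -/
lemma lt_fixed_of_lt_cfApp {l : List ℕ} (h : EvenWord l) (hne : l ≠ []) {x y : ℝ}
    (hx : x ∈ Set.Ioo (0 : ℝ) 1) (hfx : cfApp l x = x) (hy : y ∈ Set.Ioo (0 : ℝ) 1) :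
    y < cfApp l y ↔ y < x := by
  rcases lt_trichotomy y x with hlt | rfl | hgt
  · have := h.abs_cfApp_sub_cfApp_lt hne (Set.Ioo_subset_Icc_self hy)
      (Set.Ioo_subset_Icc_self hx) hlt.ne
    rw [hfx, abs_of_neg (sub_neg.2 hlt), abs_lt] at this
    exact iff_of_true (by linarith [this.1]) hlt
  · simp [hfx]
  · have := h.abs_cfApp_sub_cfApp_lt hne (Set.Ioo_subset_Icc_self hy)
      (Set.Ioo_subset_Icc_self hx) hgt.ne'
    rw [hfx, abs_of_pos (sub_pos.2 hgt), abs_lt] at this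
    exact iff_of_false (by linarith [this.2]) (by linarith)

lemma cfApp_lt_iff_fixed_lt {l : List ℕ} (h : EvenWord l) (hne : l ≠ []) {x y : ℝ}
    (hx : x ∈ Set.Ioo (0 : ℝ) 1) (hfx : cfApp l x = x) (hy : y ∈ Set.Ioo (0 : ℝ) 1) :
    cfApp l y < y ↔ x < y := by
  rcases lt_trichotomy y x with hlt | rfl | hgt
  · exact iff_of_false (not_lt.2 ((h.lt_fixed_of_lt_cfApp hne hx hfx hy).2 hlt).le) (by linarith)
  · simp [hfx]
  · have := h.abs_cfApp_sub_cfApp_lt hne (Set.Ioo_subset_Icc_self hy)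
      (Set.Ioo_subset_Icc_self hx) hgt.ne'
    rw [hfx, abs_of_pos (sub_pos.2 hgt), abs_lt] at this
    exact iff_of_true (by linarith [this.2]) hgt

/-- At `x` the word `v` moves up and the increasing `u` then lands above `u x = x`; at `y` the word
`v` does nothing and `u` moves down. Hence the fixed point of `u ++ v` is trapped. -/
lemma fixed_append {u v : List ℕ} (hu : EvenWord u) (hv : EvenWord v) (hune : u ≠ [])
    (hvne : v ≠ []) {x y z : ℝ} (hx : x ∈ Set.Ioo (0 : ℝ) 1) (hfx : cfApp u x = x)
    (hy : y ∈ Set.Ioo (0 : ℝ) 1) (hfy : cfApp v y = y) (hz : z ∈ Set.Ioo (0 : ℝ) 1)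
    (hfz : cfApp (u ++ v) z = z) (hxy : x < y) : x < z ∧ z < y := by
  have huv := hu.append hv
  have hne : u ++ v ≠ [] := by simp [hune]
  constructor
  · rw [← huv.lt_fixed_of_lt_cfApp hne hz hfz hx, cfApp_append]
    calc x = cfApp u x := hfx.symm
      _ < _ := hu.cfApp_strictMono (Set.Ioo_subset_Icc_self hx)
        (cfApp_mem_Icc hv.pos (Set.Ioo_subset_Icc_self hx))
        ((hv.lt_fixed_of_lt_cfApp hvne hy hfy hx).2 hxy)
  · rw [← huv.cfApp_lt_iff_fixed_lt hne hz hfz hy, cfApp_append, hfy]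
    exact (hu.cfApp_lt_iff_fixed_lt hune hx hfx hy).2 hxy

end EvenWord

/-- The fixed point equation unrolled to any length: the tail after `n` letters is the rest of the
current period followed by `x`. -/
lemma periodic_tail {w : List ℕ} (hne : w ≠ []) {x : ℝ} (hfx : cfApp w x = x) (n : ℕ) :
    cfApp ((List.range n).map fun k => w.getD (k % w.length) 0) (cfApp (w.drop (n % w.length)) x)
      = x := by
  have hlen : 0 < w.length := List.length_pos_iff.2 hne
  induction n with
  | zero => simpa using hfx
  | succ n ih =>
    rw [List.range_succ, List.map_append, cfApp_append]
    convert ih using 2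
    have hj : n % w.length < w.length := Nat.mod_lt _ hlen
    rw [List.drop_eq_getElem_cons hj]
    simp only [List.map_cons, List.map_nil, cfApp_cons, cfApp_nil, List.getD_eq_getElem _ _ hj]
    congr 2
    -- At the end of a period the remaining word is empty while the index restarts at `0`; the two
    -- tails agree because `cfApp w x = x`.
    rcases (Nat.succ_le_of_lt hj).eq_or_lt with h | h
    · have : (n + 1) % w.length = 0 := by
        rw [← Nat.mod_add_mod, ← Nat.succ_eq_add_one, h, Nat.mod_self]
      rw [this, ← Nat.succ_eq_add_one, h]
      simpa using hfx
    · rw [← Nat.mod_add_mod, Nat.mod_eq_of_lt h]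

/-- A purely periodic continued fraction is the fixed point of its period. -/
lemma periodicContFrac_eq {w : List ℕ} (hpos : ∀ a ∈ w, 0 < a) (hne : w ≠ []) {x : ℝ}
    (hx : x ∈ Set.Icc (0 : ℝ) 1) (hfx : cfApp w x = x) : periodicContFrac w = x := by
  have hlen : 0 < w.length := List.length_pos_iff.2 hne
  have hdig : ∀ k, 0 < w.getD (k % w.length) 0 := fun k => by
    have hj : k % w.length < w.length := Nat.mod_lt _ hlen
    rw [List.getD_eq_getElem _ _ hj]
    exact hpos _ (List.getElem_mem hj)
  refine Filter.Tendsto.limUnder_eq ?_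
  rw [tendsto_iff_dist_tendsto_zero]
  have hlim : Filter.Tendsto (fun n : ℕ => (1 / 4 : ℝ) ^ (n / 2)) Filter.atTop (nhds 0) :=
    (tendsto_pow_atTop_nhds_zero_of_lt_one (by norm_num) (by norm_num)).comp
      (Nat.tendsto_div_const_atTop (by norm_num))
  refine squeeze_zero (fun _ => dist_nonneg) (fun n => ?_) hlim
  have htail : cfApp (w.drop (n % w.length)) x ∈ Set.Icc (0 : ℝ) 1 :=
    cfApp_mem_Icc (fun a ha => hpos a (List.mem_of_mem_drop ha)) hx
  -- The `n`-th convergent and `x` are the images of `0` and of a tail in `[0, 1]` under the same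
  -- prefix.
  have h := abs_cfApp_sub_cfApp_le ((List.range n).map fun k => w.getD (k % w.length) 0)
    (by simp only [List.mem_map]; rintro _ ⟨k, -, rfl⟩; exact hdig k)
    (Set.left_mem_Icc.2 zero_le_one) htail
  rw [periodic_tail hne hfx, ← finContFrac_eq_cfApp] at h
  rw [Real.dist_eq]
  refine h.trans ?_
  simp only [List.length_map, List.length_range]
  refine mul_le_of_le_one_right (by positivity) ?_
  rw [abs_le]
  constructor <;> linarith [htail.1, htail.2]

/-! ### The matrix of a continued fraction -/

/-- The product of the matrices with rows `(0, 1)` and `(1, a)` over the letters `a`. -/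
def cfMat (l : List ℕ) : Matrix (Fin 2) (Fin 2) ℤ :=
  (l.map fun a : ℕ => !![0, 1; 1, (a : ℤ)]).prod

lemma cfMat_append (l₁ l₂ : List ℕ) : cfMat (l₁ ++ l₂) = cfMat l₁ * cfMat l₂ := by
  simp [cfMat]

lemma EvenWord.det_cfMat {l : List ℕ} (h : EvenWord l) : (cfMat l).det = 1 := by
  induction h with
  | nil => simp [cfMat]
  | cons _ _ _ ih =>
    simp only [cfMat, List.map_cons, List.prod_cons, Matrix.det_mul] at ih ⊢
    rw [ih]
    simp [Matrix.det_fin_two]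

/-- The scalar by which `cfMat l` multiplies `(y, 1)`, relative to `(cfApp l y, 1)`. -/
noncomputable def cfScale : List ℕ → ℝ → ℝ
  | [], _ => 1
  | a :: l, y => ((a : ℝ) + cfApp l y) * cfScale l y

lemma one_le_cfScale {l : List ℕ} (hl : ∀ a ∈ l, 0 < a) {y : ℝ} (hy : y ∈ Set.Icc (0 : ℝ) 1) :
    1 ≤ cfScale l y := by
  induction l with
  | nil => simp [cfScale]
  | cons a l ih =>
    have hl' : ∀ c ∈ l, 0 < c := fun c hc => hl c (by simp [hc])
    have ha : (1 : ℝ) ≤ a := by exact_mod_cast hl a (by simp)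
    have := (cfApp_mem_Icc hl' hy).1
    exact one_le_mul_of_one_le_of_one_le (by linarith) (ih hl')

lemma cfMat_mul_vec {l : List ℕ} (hl : ∀ a ∈ l, 0 < a) {y : ℝ} (hy : y ∈ Set.Icc (0 : ℝ) 1) :
    (cfMat l 0 0 : ℝ) * y + cfMat l 0 1 = cfScale l y * cfApp l y ∧
      (cfMat l 1 0 : ℝ) * y + cfMat l 1 1 = cfScale l y := by
  induction l with
  | nil => simp [cfMat, cfScale]
  | cons a l ih =>
    have hl' : ∀ c ∈ l, 0 < c := fun c hc => hl c (by simp [hc])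
    have ha : (1 : ℝ) ≤ a := by exact_mod_cast hl a (by simp)
    have h0 := (cfApp_mem_Icc hl' hy).1
    obtain ⟨h1, h2⟩ := ih hl'
    have hm : cfMat (a :: l) = !![0, 1; 1, (a : ℤ)] * cfMat l := by simp [cfMat]
    have hne : (a : ℝ) + cfApp l y ≠ 0 := by linarith
    simp only [hm, cfScale, cfApp_cons, Matrix.mul_apply, Fin.sum_univ_two]
    simp
    field_simp
    exact ⟨h2, by linear_combination h1 + a * h2⟩

/-- At the fixed point of an even word the scalar is the larger eigenvalue. -/
lemma EvenWord.log_cfScale {l : List ℕ} (h : EvenWord l) {x : ℝ}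
    (hx : x ∈ Set.Ioo (0 : ℝ) 1) (hfx : cfApp l x = x) :
    Real.log (cfScale l x) = Real.arcosh (((cfMat l).trace : ℝ) / 2) := by
  have hx' := Set.Ioo_subset_Icc_self hx
  have h1 := one_le_cfScale h.pos hx'
  obtain ⟨e1, e2⟩ := cfMat_mul_vec h.pos hx'
  have hdet := h.det_cfMat
  rw [Matrix.det_fin_two] at hdet
  have hdet' : (cfMat l 0 0 : ℝ) * cfMat l 1 1 - cfMat l 0 1 * cfMat l 1 0 = 1 := by
    exact_mod_cast hdet
  rw [hfx] at e1
  set r := cfScale l x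
  -- The characteristic equation of the eigenvalue `r`, whose eigenvector is `(x, 1)`.
  have hr : r * (((cfMat l).trace : ℤ) : ℝ) = r ^ 2 + 1 := by
    rw [Matrix.trace_fin_two]
    push_cast
    have hx0 : x ≠ 0 := hx.1.ne'
    apply mul_left_cancel₀ hx0
    linear_combination (r - (cfMat l 1 1 : ℝ)) * e1 + (cfMat l 0 1 : ℝ) * e2 + x * hdet'
  have hc : Real.cosh (Real.log r) = ((cfMat l).trace : ℝ) / 2 := by
    rw [Real.cosh_log (by linarith)]
    field_simp
    linarith
  rw [← hc, Real.arcosh_cosh (Real.log_nonneg h1)]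

/-! ### The Farey path to a periodic continued fraction -/

/-- The Farey interval `e` has determinant one and the Möbius map of `e` takes `y` to `x`. -/
def AtPoint (x : ℝ) (e : FareyEdge) (y : ℝ) : Prop :=
  e.lnum * e.rden = e.lden * e.rnum + 1 ∧ x * (e.lden * y + e.rden) = e.lnum * y + e.rnum

/-- The denominator of the Möbius map of `e` at `y`. -/
noncomputable def FareyEdge.denomAt (e : FareyEdge) (y : ℝ) : ℝ := e.lden * y + e.rden

lemma AtPoint.rden_add_lden_pos {x y : ℝ} {e : FareyEdge} (h : AtPoint x e y) :
    0 < e.lden + e.rden := by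
  have := h.1
  rcases Nat.eq_zero_or_pos e.rden with h0 | h0
  · simp [h0] at this
  · omega

/-- The Möbius map of `e` is increasing and takes `1` to the mediant. -/
lemma AtPoint.le_mediant_iff {x y : ℝ} {e : FareyEdge} (h : AtPoint x e y) (hy : 0 < y) :
    x ≤ ((e.lnum + e.rnum : ℕ) : ℝ) / ((e.lden + e.rden : ℕ) : ℝ) ↔ y ≤ 1 := by
  have hpos : (0 : ℝ) < ((e.lden + e.rden : ℕ) : ℝ) := by exact_mod_cast h.rden_add_lden_pos
  obtain ⟨h1, h2⟩ := h
  have h1' : (e.lnum : ℝ) * e.rden = e.lden * e.rnum + 1 := by exact_mod_cast h1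
  rw [le_div_iff₀ hpos]
  push_cast at hpos ⊢
  have hl : (0 : ℝ) ≤ e.lden := by positivity
  have hr : (0 : ℝ) ≤ e.rden := by positivity
  have hd : 0 < e.lden * y + e.rden := by
    rcases hl.eq_or_lt with h0 | h0
    · rw [← h0] at hpos ⊢; linarith
    · positivity
  have key : (x * (e.lden + e.rden) - (e.lnum + e.rnum)) * (e.lden * y + e.rden) = y - 1 := by
    linear_combination ((e.lden : ℝ) + e.rden) * h2 + (y - 1) * h1'
  constructor
  · intro h
    by_contra! hlt
    have : (x * (e.lden + e.rden) - (e.lnum + e.rnum)) * (e.lden * y + e.rden) ≤ 0 :=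
      mul_nonpos_of_nonpos_of_nonneg (by linarith) hd.le
    linarith
  · intro h
    by_contra! hlt
    have : 0 < (x * (e.lden + e.rden) - (e.lnum + e.rnum)) * (e.lden * y + e.rden) :=
      mul_pos (by linarith) hd
    linarith

/-- A lower step replaces the coordinate `y` by `y / (1 - y)`, that is, lowers `1 / y` by one, and
leaves `denomAt y / y` unchanged. -/
lemma AtPoint.iterate_lower {x s : ℝ} (hs : 0 < s) (a : ℕ) (e : FareyEdge)
    (h : AtPoint x e (1 / (a + s))) :
    AtPoint x ((FareyEdge.step x)^[a] e) (1 / s) ∧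
      ((FareyEdge.step x)^[a] e).denomAt (1 / s) * s = e.denomAt (1 / (a + s)) * (a + s) := by
  induction a generalizing e with
  | zero => simpa using h
  | succ a ih =>
    have hy : 1 / (((a + 1 : ℕ) : ℝ) + s) ≤ 1 := by
      rw [div_le_one (by positivity)]
      push_cast
      linarith [(Nat.cast_nonneg a : (0 : ℝ) ≤ a)]
    have hstep : FareyEdge.step x e = ⟨e.lnum + e.rnum, e.rnum, e.lden + e.rden, e.rden⟩ := by
      rw [FareyEdge.step, if_pos ((h.le_mediant_iff (by positivity)).2 hy)]
    obtain ⟨h1, h2⟩ := h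
    have hne : (a : ℝ) + s ≠ 0 := by positivity
    have hne' : (a : ℝ) + 1 + s ≠ 0 := by positivity
    have h' : AtPoint x (FareyEdge.step x e) (1 / (a + s)) := by
      rw [hstep]
      refine ⟨by linear_combination h1, ?_⟩
      push_cast at h2 ⊢
      field_simp at h2 ⊢
      linear_combination h2
    obtain ⟨h3, h4⟩ := ih _ h'
    rw [Function.iterate_succ_apply]
    refine ⟨h3, h4.trans ?_⟩
    rw [hstep]
    simp only [FareyEdge.denomAt]
    push_cast
    field_simp
    ring

/-- An upper step lowers the coordinate by one and leaves the denominator there unchanged. -/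
lemma AtPoint.iterate_upper {x y : ℝ} (hy : 0 < y) (b : ℕ) (e : FareyEdge)
    (h : AtPoint x e (b + y)) :
    AtPoint x ((FareyEdge.step x)^[b] e) y ∧
      ((FareyEdge.step x)^[b] e).denomAt y = e.denomAt (b + y) := by
  induction b generalizing e with
  | zero => simpa using h
  | succ b ih =>
    have hy' : ¬ ((b + 1 : ℕ) : ℝ) + y ≤ 1 := by
      push_cast
      linarith [(Nat.cast_nonneg b : (0 : ℝ) ≤ b)]
    have hstep : FareyEdge.step x e = ⟨e.lnum, e.lnum + e.rnum, e.lden, e.lden + e.rden⟩ := by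
      rw [FareyEdge.step, if_neg (fun h' => hy' ((h.le_mediant_iff (by positivity)).1 h'))]
    obtain ⟨h1, h2⟩ := h
    have h' : AtPoint x (FareyEdge.step x e) (b + y) := by
      rw [hstep]
      refine ⟨by linear_combination h1, ?_⟩
      push_cast at h2 ⊢
      linear_combination h2
    obtain ⟨h3, h4⟩ := ih _ h'
    rw [Function.iterate_succ_apply]
    refine ⟨h3, h4.trans ?_⟩
    rw [hstep]
    simp only [FareyEdge.denomAt]
    push_cast
    ring

lemma AtPoint.iterate_word {l : List ℕ} (hl : EvenWord l) {x y : ℝ}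
    (hy : y ∈ Set.Ioo (0 : ℝ) 1) (e : FareyEdge) (h : AtPoint x e (cfApp l y)) :
    AtPoint x ((FareyEdge.step x)^[l.sum] e) y ∧
      ((FareyEdge.step x)^[l.sum] e).denomAt y = e.denomAt (cfApp l y) * cfScale l y := by
  induction hl generalizing e with
  | nil => simpa [cfScale] using h
  | @cons a b l ha hb hl ih =>
    have ht : 0 < cfApp l y := by
      by_cases hne : l = []
      · simpa [hne] using hy.1
      · exact (hl.cfApp_mem_Ioo hne (Set.Ioo_subset_Icc_self hy)).1
    have hs : 0 < 1 / ((b : ℝ) + cfApp l y) := by positivity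
    obtain ⟨h1, h2⟩ := AtPoint.iterate_lower hs a e h
    rw [one_div_one_div] at h1 h2
    obtain ⟨h3, h4⟩ := AtPoint.iterate_upper ht b _ h1
    obtain ⟨h5, h6⟩ := ih _ h3
    have hit : (FareyEdge.step x)^[(a :: b :: l).sum] e =
        (FareyEdge.step x)^[l.sum] ((FareyEdge.step x)^[b] ((FareyEdge.step x)^[a] e)) := by
      rw [← Function.iterate_add_apply, ← Function.iterate_add_apply]
      congr 2
      simp
      ring
    rw [hit]
    refine ⟨h5, h6.trans ?_⟩
    rw [h4]
    simp only [cfScale, cfApp_cons]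
    rw [mul_one_div, div_eq_iff (by positivity)] at h2
    rw [h2]
    ring

lemma euclidMax_mono (x : ℝ) : Monotone (euclidMax x) := by
  refine monotone_nat_of_le_succ fun n => ?_
  unfold euclidMax fareyPath
  rw [Function.iterate_succ_apply']
  generalize (FareyEdge.step x)^[n] FareyEdge.root = e
  unfold FareyEdge.step
  split_ifs <;> simp

/-- Since `w` fixes `x`, each block of `w.sum` steps restores the coordinate `x`; the root is the
identity matrix, with denominator `1`. -/
lemma atPoint_fareyPath {w : List ℕ} (hw : EvenWord w) {x : ℝ} (hx : x ∈ Set.Ioo (0 : ℝ) 1)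
    (hfx : cfApp w x = x) (k : ℕ) :
    AtPoint x (fareyPath x (k * w.sum)) x ∧
      (fareyPath x (k * w.sum)).denomAt x = cfScale w x ^ k := by
  induction k with
  | zero => simp [fareyPath, FareyEdge.root, AtPoint, FareyEdge.denomAt]
  | succ k ih =>
    have h := AtPoint.iterate_word hw hx (fareyPath x (k * w.sum)) (by rw [hfx]; exact ih.1)
    have hp : fareyPath x ((k + 1) * w.sum) =
        (FareyEdge.step x)^[w.sum] (fareyPath x (k * w.sum)) := by
      rw [fareyPath, fareyPath, ← Function.iterate_add_apply]
      congr 2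
      ring
    rw [hp]
    refine ⟨h.1, h.2.trans ?_⟩
    rw [hfx, ih.2, pow_succ]

lemma euclidMax_bounds {w : List ℕ} (hw : EvenWord w) {x : ℝ} (hx : x ∈ Set.Ioo (0 : ℝ) 1)
    (hfx : cfApp w x = x) (k : ℕ) :
    cfScale w x ^ k ≤ euclidMax x (k * w.sum) ∧
      (euclidMax x (k * w.sum) : ℝ) * x ≤ cfScale w x ^ k := by
  rw [← (atPoint_fareyPath hw hx hfx k).2]
  simp only [euclidMax, FareyEdge.denomAt]
  push_cast
  have h1 : (0 : ℝ) ≤ (fareyPath x (k * w.sum)).lden := by positivity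
  have h2 : (0 : ℝ) ≤ (fareyPath x (k * w.sum)).rden := by positivity
  constructor <;> nlinarith [hx.1, hx.2]

lemma tendsto_div_of_abs_sub_le {u : ℕ → ℝ} {c K : ℝ} (h : ∀ n, |u n - n * c| ≤ K) :
    Filter.Tendsto (fun n : ℕ => u n / n) Filter.atTop (nhds c) := by
  rw [tendsto_iff_dist_tendsto_zero]
  refine squeeze_zero' (Filter.Eventually.of_forall fun _ => dist_nonneg) ?_
    (tendsto_const_div_atTop_nhds_zero_nat K)
  filter_upwards [Filter.eventually_gt_atTop 0] with n hn
  have hn : (0 : ℝ) < n := by exact_mod_cast hn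
  rw [Real.dist_eq, show u n / n - c = (u n - n * c) / n by field_simp, abs_div, abs_of_pos hn]
  exact div_le_div_of_nonneg_right (h n) hn.le

/-- The Lyapunov exponent of a purely periodic continued fraction with even period. -/
theorem lyapunov_eq {w : List ℕ} (hw : EvenWord w) (hne : w ≠ []) {x : ℝ}
    (hx : x ∈ Set.Ioo (0 : ℝ) 1) (hfx : cfApp w x = x) :
    lyapunov x = 1 / (w.sum : ℝ) * Real.arcosh (((cfMat w).trace : ℝ) / 2) := by
  have hx' := Set.Ioo_subset_Icc_self hx
  rw [← hw.log_cfScale hx hfx, lyapunov, abs_of_pos hx.1]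
  have hr := one_le_cfScale hw.pos hx'
  have hS : 0 < w.sum := hw.sum_pos hne
  set S := w.sum with hSdef
  set r := cfScale w x
  have hlog : 0 ≤ Real.log r := Real.log_nonneg hr
  have hSr : (0 : ℝ) < S := by exact_mod_cast hS
  have lower : ∀ k : ℕ, k * Real.log r ≤ Real.log (euclidMax x (k * S)) := fun k => by
    rw [← Real.log_pow]
    exact Real.log_le_log (by positivity) (euclidMax_bounds hw hx hfx k).1
  have hpos : ∀ k : ℕ, (0 : ℝ) < euclidMax x (k * S) := fun k =>
    lt_of_lt_of_le (by positivity) (euclidMax_bounds hw hx hfx k).1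
  have upper : ∀ k : ℕ, Real.log (euclidMax x (k * S)) ≤ k * Real.log r - Real.log x := fun k => by
    have h := Real.log_le_log (mul_pos (hpos k) hx.1) (euclidMax_bounds hw hx hfx k).2
    rw [Real.log_mul (hpos k).ne' hx.1.ne', Real.log_pow] at h
    linarith
  have hx1 : Real.log x ≤ 0 := Real.log_nonpos hx.1.le hx.2.le
  -- Between consecutive multiples of `S` monotonicity of `w_n` loses at most a factor `r`, and
  -- `euclidMax_bounds` a factor `1 / x`; this is the constant `K`.
  refine Filter.Tendsto.limsup_eq (tendsto_div_of_abs_sub_le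
    (K := Real.log r - Real.log x) fun n => ?_)
  have hk1 : n / S * S ≤ n := Nat.div_mul_le_self n S
  have hk2 : n ≤ (n / S + 1) * S := by
    have := Nat.div_add_mod n S
    have := Nat.mod_lt n hS
    nlinarith
  have hn0 : (0 : ℝ) < euclidMax x n := by
    have := hpos 0
    have hmono : euclidMax x (0 * S) ≤ euclidMax x n := euclidMax_mono x (by simp)
    exact this.trans_le (by exact_mod_cast hmono)
  have l1 : Real.log (euclidMax x (n / S * S)) ≤ Real.log (euclidMax x n) :=
    Real.log_le_log (hpos _) (by exact_mod_cast euclidMax_mono x hk1)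
  have l2 : Real.log (euclidMax x n) ≤ Real.log (euclidMax x ((n / S + 1) * S)) :=
    Real.log_le_log hn0 (by exact_mod_cast euclidMax_mono x hk2)
  have l3 := lower (n / S)
  have l4 := upper (n / S + 1)
  have k1 : ((n / S : ℕ) : ℝ) ≤ n / S := Nat.cast_div_le
  have k2 : (n : ℝ) / S ≤ (n / S : ℕ) + 1 := by
    rw [div_le_iff₀ hSr]
    exact_mod_cast hk2
  have e : (n : ℝ) * (1 / S * Real.log r) = n / S * Real.log r := by ring
  push_cast at l4
  rw [e, abs_le]
  constructor <;> nlinarith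

/-! ### The vertices of the tree -/

/-- Cayley–Hamilton: `A² = (tr A) A - 1` when `det A = 1`. -/
lemma trace_mul_mul_self_right (A B : Matrix (Fin 2) (Fin 2) ℤ) (hA : A.det = 1) :
    (B * A * A).trace = (B * A).trace * A.trace - B.trace := by
  rw [Matrix.det_fin_two] at hA
  simp only [Matrix.trace_fin_two, Matrix.mul_apply, Fin.sum_univ_two]
  linear_combination (-(B 0 0) - B 1 1) * hA

lemma trace_mul_self_mul_left (A B : Matrix (Fin 2) (Fin 2) ℤ) (hB : B.det = 1) :
    (B * (B * A)).trace = B.trace * (B * A).trace - A.trace := by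
  rw [Matrix.det_fin_two] at hB
  simp only [Matrix.trace_fin_two, Matrix.mul_apply, Fin.sum_univ_two]
  linear_combination (-(A 0 0) - A 1 1) * hB

namespace TreeVertex

/-- `v.Below w`: the vertex `w` is reached from `v` by going down the tree. -/
inductive Below (v : TreeVertex) : TreeVertex → Prop
  | refl : Below v v
  | left {w : TreeVertex} (h : Below v w) : Below v w.left
  | right {w : TreeVertex} (h : Below v w) : Below v w.right

lemma Below.trans {u v w : TreeVertex} (h₁ : u.Below v) (h₂ : v.Below w) : u.Below w := by
  induction h₂ with
  | refl => exact h₁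
  | left _ ih => exact ih.left
  | right _ ih => exact ih.right

lemma Below.eq_or {v w : TreeVertex} (h : v.Below w) :
    w = v ∨ v.left.Below w ∨ v.right.Below w := by
  induction h with
  | refl => exact .inl rfl
  | left _ ih =>
    rcases ih with rfl | h | h
    exacts [.inr (.inl .refl), .inr (.inl h.left), .inr (.inr h.left)]
  | right _ ih =>
    rcases ih with rfl | h | h
    exacts [.inr (.inr .refl), .inr (.inl h.right), .inr (.inr h.right)]

/-- The Farey fraction of the left region. -/
def lfrac (v : TreeVertex) : ℚ := (v.lnum : ℚ) / v.lden

/-- The Farey fraction of the right region. -/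
def rfrac (v : TreeVertex) : ℚ := (v.rnum : ℚ) / v.rden

/-- The invariants of the vertices of the tree: neighbouring Farey fractions, the Markov equation,
and the relation of the periods to denominators and Markov numbers. -/
structure Good (v : TreeVertex) : Prop where
  det : v.rnum * v.lden = v.lnum * v.rden + 1
  lden_pos : 0 < v.lden
  rden_pos : 0 < v.rden
  lmark_pos : 1 ≤ v.lmark
  rmark_pos : 1 ≤ v.rmark
  lmark_le : v.lmark ≤ v.mark
  rmark_le : v.rmark ≤ v.mark
  markov : v.lmark ^ 2 + v.rmark ^ 2 + v.mark ^ 2 = 3 * v.lmark * v.rmark * v.mark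
  lword : EvenWord v.lper
  rword : EvenWord v.rper
  lper_ne : v.lper ≠ []
  rper_ne : v.rper ≠ []
  lsum : v.lper.sum = 2 * v.lden
  rsum : v.rper.sum = 2 * v.rden
  ltrace : (cfMat v.lper).trace = 3 * v.lmark
  rtrace : (cfMat v.rper).trace = 3 * v.rmark
  trace : (cfMat v.per).trace = 3 * v.mark

lemma good_root : root.Good := by
  constructor <;> try simp [root]
  · exact .cons one_pos one_pos .nil
  · exact .cons two_pos two_pos .nil
  · simp [cfMat, Matrix.trace_fin_two]
  · simp [cfMat, Matrix.trace_fin_two]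
  · simp [cfMat, per, Matrix.trace_fin_two]

namespace Good

variable {v : TreeVertex}

lemma mark_pos (h : v.Good) : 1 ≤ v.mark := h.lmark_pos.trans h.lmark_le

lemma word (h : v.Good) : EvenWord v.per := h.rword.append h.lword

lemma per_ne (h : v.Good) : v.per ≠ [] := by simp [TreeVertex.per, h.rper_ne]

lemma sum (h : v.Good) : v.per.sum = 2 * (v.lden + v.rden) := by
  simp [TreeVertex.per, h.lsum, h.rsum]
  ring

/-- The new period is `rper ++ lper ++ lper`, so the trace identity yields `3m · 3l - 3r`, three
times the Vieta image. -/
lemma left (h : v.Good) : v.left.Good where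
  det := by
    have := h.det
    simp only [TreeVertex.left]
    linear_combination this
  lden_pos := h.lden_pos
  rden_pos := Nat.add_pos_left h.lden_pos _
  lmark_pos := h.lmark_pos
  rmark_pos := h.mark_pos
  lmark_le := by
    have := h.lmark_pos
    have := h.lmark_le
    have := h.rmark_le
    simp only [TreeVertex.left]
    nlinarith
  rmark_le := by
    have := h.lmark_pos
    have := h.lmark_le
    have := h.rmark_le
    simp only [TreeVertex.left]
    nlinarith
  markov := by
    have := h.markov
    simp only [TreeVertex.left]
    linear_combination this
  lword := h.lword
  rword := h.word
  lper_ne := h.lper_ne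
  rper_ne := h.per_ne
  lsum := h.lsum
  rsum := h.sum
  ltrace := h.ltrace
  rtrace := h.trace
  trace := by
    have h1 := h.trace
    simp only [TreeVertex.per, TreeVertex.left, cfMat_append] at h1 ⊢
    rw [trace_mul_mul_self_right _ _ h.lword.det_cfMat, h1, h.ltrace, h.rtrace]
    ring

lemma right (h : v.Good) : v.right.Good where
  det := by
    have := h.det
    simp only [TreeVertex.right]
    linear_combination this
  lden_pos := Nat.add_pos_left h.lden_pos _
  rden_pos := h.rden_pos
  lmark_pos := h.mark_pos
  rmark_pos := h.rmark_pos
  lmark_le := by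
    have := h.rmark_pos
    have := h.lmark_le
    have := h.rmark_le
    simp only [TreeVertex.right]
    nlinarith
  rmark_le := by
    have := h.rmark_pos
    have := h.lmark_le
    have := h.rmark_le
    simp only [TreeVertex.right]
    nlinarith
  markov := by
    have := h.markov
    simp only [TreeVertex.right]
    linear_combination this
  lword := h.word
  rword := h.rword
  lper_ne := h.per_ne
  rper_ne := h.rper_ne
  lsum := h.sum
  rsum := h.rsum
  ltrace := h.trace
  rtrace := h.rtrace
  trace := by
    have h1 := h.trace
    simp only [TreeVertex.per, TreeVertex.right, cfMat_append] at h1 ⊢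
    rw [trace_mul_self_mul_left _ _ h.rword.det_cfMat, h1, h.ltrace, h.rtrace]
    ring

lemma below (h : v.Good) {w : TreeVertex} (hw : v.Below w) : w.Good := by
  induction hw with
  | refl => exact h
  | left _ ih => exact ih.left
  | right _ ih => exact ih.right

lemma lfrac_lt_mediant (h : v.Good) : v.lfrac < v.mediant := by
  have h1 : (0 : ℚ) < v.lden := by exact_mod_cast h.lden_pos
  have h2 : (0 : ℚ) < v.rden := by exact_mod_cast h.rden_pos
  have h3 : (v.rnum : ℚ) * v.lden = v.lnum * v.rden + 1 := by exact_mod_cast h.det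
  rw [lfrac, mediant]
  push_cast
  rw [div_lt_div_iff₀ h1 (by positivity)]
  linarith

lemma mediant_lt_rfrac (h : v.Good) : v.mediant < v.rfrac := by
  have h1 : (0 : ℚ) < v.lden := by exact_mod_cast h.lden_pos
  have h2 : (0 : ℚ) < v.rden := by exact_mod_cast h.rden_pos
  have h3 : (v.rnum : ℚ) * v.lden = v.lnum * v.rden + 1 := by exact_mod_cast h.det
  rw [rfrac, mediant]
  push_cast
  rw [div_lt_div_iff₀ (by positivity) h2]
  linarith

lemma frac_bounds (h : v.Good) {w : TreeVertex} (hw : v.Below w) :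
    v.lfrac ≤ w.lfrac ∧ w.rfrac ≤ v.rfrac := by
  induction hw with
  | refl => exact ⟨le_rfl, le_rfl⟩
  | left hw ih => exact ⟨ih.1, (h.below hw).mediant_lt_rfrac.le.trans ih.2⟩
  | right hw ih => exact ⟨ih.1.trans (h.below hw).lfrac_lt_mediant.le, ih.2⟩

lemma mediant_mem (h : v.Good) {w : TreeVertex} (hw : v.Below w) :
    w.mediant ∈ Set.Ioo v.lfrac v.rfrac :=
  ⟨(h.frac_bounds hw).1.trans_lt (h.below hw).lfrac_lt_mediant,
    (h.below hw).mediant_lt_rfrac.trans_le (h.frac_bounds hw).2⟩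

/-- By determinant one, `ξ.den` is the combination of `lden` and `rden` whose coefficients are the
cross determinants of `ξ` with the opposite endpoints, both positive integers. -/
lemma den_le (h : v.Good) {ξ : ℚ} (hξ : ξ ∈ Set.Ioo v.lfrac v.rfrac) :
    v.lden + v.rden ≤ ξ.den := by
  obtain ⟨h1, h2⟩ := hξ
  have hl : (0 : ℚ) < v.lden := by exact_mod_cast h.lden_pos
  have hr : (0 : ℚ) < v.rden := by exact_mod_cast h.rden_pos
  have hd : (0 : ℚ) < ξ.den := by exact_mod_cast ξ.den_pos
  have h3 : (v.rnum : ℤ) * v.lden = v.lnum * v.rden + 1 := by exact_mod_cast h.det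
  rw [← Rat.num_div_den ξ, lfrac, div_lt_div_iff₀ hl hd] at h1
  rw [← Rat.num_div_den ξ, rfrac, div_lt_div_iff₀ hd hr] at h2
  have h1' : (v.lnum : ℤ) * ξ.den + 1 ≤ ξ.num * v.lden := by exact_mod_cast h1
  have h2' : ξ.num * (v.rden : ℤ) + 1 ≤ v.rnum * ξ.den := by exact_mod_cast h2
  have hl' : (0 : ℤ) ≤ v.lden := by positivity
  have hr' : (0 : ℤ) ≤ v.rden := by positivity
  have key : (ξ.den : ℤ) = v.lden * (v.rnum * ξ.den - ξ.num * v.rden) +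
      v.rden * (ξ.num * v.lden - v.lnum * ξ.den) := by
    linear_combination (-(ξ.den : ℤ)) * h3
  have : (v.lden : ℤ) + v.rden ≤ ξ.den := by nlinarith
  exact_mod_cast this

end Good

lemma num_den_of_eq {a b c d : ℕ} (hb : 0 < b) (h : c * b = a * d + 1 ∨ a * d = c * b + 1) :
    ((a : ℚ) / b).num = a ∧ ((a : ℚ) / b).den = b := by
  have hc : Nat.Coprime a b := by
    rw [← Nat.isCoprime_iff_coprime]
    rcases h with h | h
    · exact ⟨-d, c, by have : (c : ℤ) * b = a * d + 1 := by exact_mod_cast h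
                       linear_combination this⟩
    · exact ⟨d, -c, by have : (a : ℤ) * d = c * b + 1 := by exact_mod_cast h
                       linear_combination this⟩
  have hb' : (0 : ℤ) < b := by exact_mod_cast hb
  have hc' : Nat.Coprime (a : ℤ).natAbs (b : ℤ).natAbs := by simpa using hc
  have h1 := Rat.num_div_eq_of_coprime hb' hc'
  have h2 := Rat.den_div_eq_of_coprime hb' hc'
  push_cast at h1 h2
  exact ⟨h1, by exact_mod_cast h2⟩

/-! ### Reduced fractions and the search for a vertex. -/

namespace Good

variable {v : TreeVertex}

lemma num_den_lfrac (h : v.Good) : v.lfrac.num = v.lnum ∧ v.lfrac.den = v.lden :=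
  num_den_of_eq h.lden_pos (.inl h.det)

lemma num_den_rfrac (h : v.Good) : v.rfrac.num = v.rnum ∧ v.rfrac.den = v.rden :=
  num_den_of_eq (c := v.lnum) (d := v.lden) h.rden_pos (.inr h.det)

lemma num_den_mediant (h : v.Good) :
    v.mediant.num = (v.lnum + v.rnum : ℕ) ∧ v.mediant.den = v.lden + v.rden :=
  -- The mediant is by definition the right fraction of the left child.
  h.left.num_den_rfrac

/-- Each descent increases `lden + rden`, which `den_le` bounds by `ξ.den`; so `n` steps suffice,
and surplus steps stay at the vertex found. -/
lemma iterate_step (h : v.Good) {ξ : ℚ} (n : ℕ) (hξ : ξ ∈ Set.Ioo v.lfrac v.rfrac)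
    (hn : ξ.den < v.lden + v.rden + n) :
    v.Below ((step ξ)^[n] v) ∧ ((step ξ)^[n] v).mediant = ξ := by
  induction n generalizing v with
  | zero => exact absurd (h.den_le hξ) (by omega)
  | succ n ih =>
    rw [Function.iterate_succ_apply]
    have hl := h.lden_pos
    have hr := h.rden_pos
    rcases lt_trichotomy ξ v.mediant with hlt | heq | hgt
    · rw [step, if_pos hlt]
      obtain ⟨h1, h2⟩ := ih h.left ⟨hξ.1, hlt⟩ (by simp only [TreeVertex.left]; omega)
      exact ⟨Below.refl.left.trans h1, h2⟩
    · have hfix : step ξ v = v := by simp [step, heq]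
      rw [hfix, Function.iterate_fixed hfix]
      exact ⟨.refl, heq.symm⟩
    · rw [step, if_neg hgt.not_gt, if_pos hgt]
      obtain ⟨h1, h2⟩ := ih h.right ⟨hgt, hξ.2⟩ (by simp only [TreeVertex.right]; omega)
      exact ⟨Below.refl.right.trans h1, h2⟩

lemma exists_below (h : v.Good) {ξ : ℚ} (hξ : ξ ∈ Set.Ioo v.lfrac v.rfrac) :
    ∃ w, v.Below w ∧ w.mediant = ξ :=
  ⟨_, h.iterate_step (ξ.den + 1) hξ (by omega)⟩

lemma below_step (h : v.Good) {w : TreeVertex} (hw : v.Below w) :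
    (step w.mediant v).Below w := by
  rcases hw.eq_or with rfl | hl | hr
  · simpa [step] using Below.refl
  · have : w.mediant < v.mediant := (h.left.mediant_mem hl).2
    rw [step, if_pos this]
    exact hl
  · have : v.mediant < w.mediant := (h.right.mediant_mem hr).1
    rw [step, if_neg this.not_gt, if_pos this]
    exact hr

lemma eq_of_mediant_eq (h : v.Good) {w : TreeVertex} (hw : v.Below w)
    (heq : v.mediant = w.mediant) : v = w := by
  rcases hw.eq_or with rfl | hl | hr
  · rfl
  · exact absurd heq (h.left.mediant_mem hl).2.ne'
  · exact absurd heq (h.right.mediant_mem hr).1.ne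

end Good

lemma lfrac_root : root.lfrac = 0 := by simp [lfrac, root]

lemma rfrac_root : root.rfrac = 1 / 2 := by simp [rfrac, root]

lemma below_vertexOf {ξ : ℚ} (hξ : ξ ∈ Set.Ioo (0 : ℚ) (1 / 2)) :
    root.Below (vertexOf ξ) ∧ (vertexOf ξ).mediant = ξ :=
  good_root.iterate_step ξ.den (by rwa [lfrac_root, rfrac_root]) (by simp [root])

lemma Below.mediant_mem {v : TreeVertex} (h : root.Below v) :
    v.mediant ∈ Set.Ioo (0 : ℚ) (1 / 2) := by
  have := good_root.mediant_mem h
  rwa [lfrac_root, rfrac_root] at this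

/-- The search for the mediant of `v` only visits vertices above `v` or `v` itself, and among these
only `v` has that mediant. -/
lemma Below.vertexOf_mediant {v : TreeVertex} (h : root.Below v) : vertexOf v.mediant = v := by
  obtain ⟨h1, h2⟩ := below_vertexOf h.mediant_mem
  refine (good_root.below h1).eq_of_mediant_eq ?_ h2
  rw [vertexOf]
  suffices H : ∀ n, root.Below ((step v.mediant)^[n] root) ∧
      ((step v.mediant)^[n] root).Below v from (H _).2
  intro n
  induction n with
  | zero => exact ⟨.refl, h⟩
  | succ n ih =>
    rw [Function.iterate_succ_apply']
    refine ⟨?_, (good_root.below ih.1).below_step ih.2⟩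
    rw [step]
    split_ifs
    exacts [ih.1.left, ih.1.right, ih.1]

lemma Below.markovNumber_mediant {v : TreeVertex} (h : root.Below v) :
    markovNumber v.mediant = v.mark := by
  rw [markovNumber, if_neg h.mediant_mem.1.ne', if_neg h.mediant_mem.2.ne, h.vertexOf_mediant]

lemma Below.hurwitzPeriod_mediant {v : TreeVertex} (h : root.Below v) :
    hurwitzPeriod v.mediant = v.per := by
  rw [hurwitzPeriod, if_neg h.mediant_mem.1.ne', if_neg h.mediant_mem.2.ne, h.vertexOf_mediant]

lemma Below.markovNumber_frac {v : TreeVertex} (h : root.Below v) :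
    markovNumber v.lfrac = v.lmark ∧ markovNumber v.rfrac = v.rmark := by
  induction h with
  | refl => rw [lfrac_root, rfrac_root]; simp [markovNumber, root]
  | left h ih => exact ⟨ih.1, h.markovNumber_mediant⟩
  | right h ih => exact ⟨h.markovNumber_mediant, ih.2⟩

lemma Below.hurwitzPeriod_frac {v : TreeVertex} (h : root.Below v) :
    hurwitzPeriod v.lfrac = v.lper ∧ hurwitzPeriod v.rfrac = v.rper := by
  induction h with
  | refl => rw [lfrac_root, rfrac_root]; simp [hurwitzPeriod, root]
  | left h ih => exact ⟨ih.1, h.hurwitzPeriod_mediant⟩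
  | right h ih => exact ⟨h.hurwitzPeriod_mediant, ih.2⟩

lemma eq_zero_or_eq_half_or_exists_mediant {ξ : ℚ} (hξ : ξ ∈ Set.Icc (0 : ℚ) (1 / 2)) :
    ξ = 0 ∨ ξ = 1 / 2 ∨ ∃ v, root.Below v ∧ v.mediant = ξ := by
  rcases hξ.1.eq_or_lt with h | h
  · exact .inl h.symm
  rcases hξ.2.eq_or_lt with h' | h'
  · exact .inr (.inl h')
  · exact .inr (.inr ⟨_, below_vertexOf ⟨h, h'⟩⟩)

/-- A function on `[0, 1/2] ∩ ℚ` is strictly decreasing if it is so at every Farey triple. -/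
lemma strictAntiOn_of_vertex {X : ℚ → ℝ}
    (hX : ∀ v, root.Below v → X v.mediant < X v.lfrac ∧ X v.rfrac < X v.mediant) :
    StrictAntiOn X (Set.Icc (0 : ℚ) (1 / 2)) := by
  have down : ∀ v, root.Below v → ∀ w, v.Below w →
      X w.lfrac ≤ X v.lfrac ∧ X v.rfrac ≤ X w.rfrac := by
    intro v hv w hw
    induction hw with
    | refl => exact ⟨le_rfl, le_rfl⟩
    | left hw ih => exact ⟨ih.1, ih.2.trans (hX _ (hv.trans hw)).2.le⟩
    | right hw ih => exact ⟨(hX _ (hv.trans hw)).1.le.trans ih.1, ih.2⟩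
  have inside : ∀ v, root.Below v → ∀ ξ ∈ Set.Ioo v.lfrac v.rfrac,
      X ξ < X v.lfrac ∧ X v.rfrac < X ξ := by
    intro v hv ξ hξ
    obtain ⟨w, hw, rfl⟩ := (good_root.below hv).exists_below hξ
    have := hX w (hv.trans hw)
    have := down v hv w hw
    constructor <;> linarith
  -- Points outside the interval of a child lie in the sibling's interval, at an endpoint of the
  -- parent's interval, or outside the latter.
  have up : ∀ v, root.Below v → ∀ η ∈ Set.Icc (0 : ℚ) (1 / 2),
      (v.rfrac < η → X η < X v.rfrac) ∧ (η < v.lfrac → X v.lfrac < X η) := by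
    intro v hv
    induction hv with
    | refl =>
      intro η hη
      rw [lfrac_root, rfrac_root]
      exact ⟨fun h => absurd hη.2 h.not_ge, fun h => absurd hη.1 h.not_ge⟩
    | @left v hv ih =>
      refine fun η hη => ⟨fun (h : v.mediant < η) => ?_, (ih η hη).2⟩
      change X η < X v.mediant
      rcases lt_trichotomy η v.rfrac with h1 | rfl | h1
      · exact (inside _ hv.right η ⟨h, h1⟩).1
      · exact (hX v hv).2
      · exact ((ih η hη).1 h1).trans (hX v hv).2
    | @right v hv ih =>
      refine fun η hη => ⟨(ih η hη).1, fun (h : η < v.mediant) => ?_⟩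
      change X v.mediant < X η
      rcases lt_trichotomy v.lfrac η with h1 | rfl | h1
      · exact (inside _ hv.left η ⟨h1, h⟩).2
      · exact (hX v hv).1
      · exact (hX v hv).1.trans ((ih η hη).2 h1)
  intro ξ hξ η hη hlt
  rcases eq_zero_or_eq_half_or_exists_mediant hξ with rfl | rfl | ⟨v, hv, rfl⟩
  · rcases hη.2.eq_or_lt with rfl | h
    · have := hX root .refl
      rw [lfrac_root, rfrac_root] at this
      exact this.2.trans this.1
    · have := inside root .refl η (by rw [lfrac_root, rfrac_root]; exact ⟨hlt, h⟩)
      rw [lfrac_root] at this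
      exact this.1
  · exact absurd hη.2 hlt.not_ge
  · exact (up v.left hv.left η hη).1 hlt

end TreeVertex

/-! ### Markov–Hurwitz numbers -/

lemma EvenWord.periodicContFrac_fixed {w : List ℕ} (hw : EvenWord w) (hne : w ≠ []) :
    periodicContFrac w ∈ Set.Ioo (0 : ℝ) 1 ∧ cfApp w (periodicContFrac w) = periodicContFrac w := by
  obtain ⟨x, hx, hfx⟩ := hw.exists_fixed hne
  rw [periodicContFrac_eq hw.pos hne (Set.Ioo_subset_Icc_self hx) hfx]
  exact ⟨hx, hfx⟩

lemma evenWord_hurwitzPeriod {ξ : ℚ} (hξ : ξ ∈ Set.Icc (0 : ℚ) (1 / 2)) :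
    EvenWord (hurwitzPeriod ξ) ∧ hurwitzPeriod ξ ≠ [] ∧ (hurwitzPeriod ξ).sum = 2 * ξ.den ∧
      (cfMat (hurwitzPeriod ξ)).trace = 3 * markovNumber ξ := by
  rcases TreeVertex.eq_zero_or_eq_half_or_exists_mediant hξ with rfl | rfl | ⟨v, hv, rfl⟩
  · have h := TreeVertex.good_root
    have h1 := (TreeVertex.Below.refl (v := TreeVertex.root)).markovNumber_frac.1
    have h2 := (TreeVertex.Below.refl (v := TreeVertex.root)).hurwitzPeriod_frac.1
    rw [← TreeVertex.lfrac_root, h1, h2, h.num_den_lfrac.2]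
    exact ⟨h.lword, h.lper_ne, h.lsum, h.ltrace⟩
  · have h := TreeVertex.good_root
    have h1 := (TreeVertex.Below.refl (v := TreeVertex.root)).markovNumber_frac.2
    have h2 := (TreeVertex.Below.refl (v := TreeVertex.root)).hurwitzPeriod_frac.2
    rw [← TreeVertex.rfrac_root, h1, h2, h.num_den_rfrac.2]
    exact ⟨h.rword, h.rper_ne, h.rsum, h.rtrace⟩
  · have h := TreeVertex.good_root.below hv
    rw [hv.markovNumber_mediant, hv.hurwitzPeriod_mediant, h.num_den_mediant.2]
    exact ⟨h.word, h.per_ne, h.sum, h.trace⟩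

theorem lyapunov_hurwitzNumber {ξ : ℚ} (hξ : ξ ∈ Set.Icc (0 : ℚ) (1 / 2)) :
    lyapunov (hurwitzNumber ξ) =
      1 / (2 * (ξ.den : ℝ)) * Real.arcosh (3 * (markovNumber ξ : ℝ) / 2) := by
  obtain ⟨hw, hne, hsum, htr⟩ := evenWord_hurwitzPeriod hξ
  obtain ⟨hx, hfx⟩ := hw.periodicContFrac_fixed hne
  rw [hurwitzNumber, lyapunov_eq hw hne hx hfx, hsum, htr]
  push_cast
  rfl

lemma hurwitzNumber_zero : hurwitzNumber 0 = (√5 - 1) / 2 := by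
  obtain ⟨h, h'⟩ := (EvenWord.cons one_pos one_pos .nil).periodicContFrac_fixed (by simp)
  have e : hurwitzNumber 0 = periodicContFrac [1, 1] := by simp [hurwitzNumber, hurwitzPeriod]
  rw [e]
  set x := periodicContFrac [1, 1]
  have hx := h.1
  simp only [cfApp_cons, cfApp_nil] at h'
  field_simp at h'
  have h5 : √5 = 2 * x + 1 := by
    rw [Real.sqrt_eq_iff_mul_self_eq (by norm_num) (by linarith)]
    push_cast at h'
    linear_combination 4 * h'
  linarith

lemma hurwitzNumber_half : hurwitzNumber (1 / 2) = √2 - 1 := by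
  obtain ⟨h, h'⟩ := (EvenWord.cons two_pos two_pos .nil).periodicContFrac_fixed (by simp)
  have e : hurwitzNumber (1 / 2) = periodicContFrac [2, 2] := by
    simp [hurwitzNumber, hurwitzPeriod]
  rw [e]
  set x := periodicContFrac [2, 2]
  have hx := h.1
  simp only [cfApp_cons, cfApp_nil] at h'
  field_simp at h'
  have h5 : √2 = x + 1 := by
    rw [Real.sqrt_eq_iff_mul_self_eq (by norm_num) (by linarith)]
    push_cast at h'
    linear_combination (1 / 2) * h'
  linarith

/-- The order `√2 - 1 < (√5 - 1) / 2` at the root is inherited by all vertices through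
`EvenWord.fixed_append`. -/
lemma TreeVertex.Below.periodicContFrac_lt {v : TreeVertex} (h : TreeVertex.root.Below v) :
    periodicContFrac v.per < periodicContFrac v.lper ∧
      periodicContFrac v.rper < periodicContFrac v.per := by
  have key : ∀ v : TreeVertex, v.Good → periodicContFrac v.rper < periodicContFrac v.lper →
      periodicContFrac v.per < periodicContFrac v.lper ∧
      periodicContFrac v.rper < periodicContFrac v.per := fun v hv hlt => by
    obtain ⟨h1, h2⟩ := hv.rword.periodicContFrac_fixed hv.rper_ne
    obtain ⟨h3, h4⟩ := hv.lword.periodicContFrac_fixed hv.lper_ne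
    obtain ⟨h5, h6⟩ := hv.word.periodicContFrac_fixed hv.per_ne
    exact (hv.rword.fixed_append hv.lword hv.rper_ne hv.lper_ne h1 h2 h3 h4 h5 h6 hlt).symm
  refine key v (TreeVertex.good_root.below h) ?_
  induction h with
  | refl =>
    have h0 := hurwitzNumber_zero
    have h1 := hurwitzNumber_half
    simp only [hurwitzNumber, hurwitzPeriod] at h0 h1
    norm_num at h0 h1
    simp only [TreeVertex.root]
    rw [h0, h1]
    have : √2 < 3 / 2 := by rw [Real.sqrt_lt' (by norm_num)]; norm_num
    have : 2 < √5 := by rw [Real.lt_sqrt (by norm_num)]; norm_num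
    linarith
  | left h ih => exact (key _ (TreeVertex.good_root.below h) ih).1
  | right h ih => exact (key _ (TreeVertex.good_root.below h) ih).2

theorem hurwitzNumber_strictAntiOn : StrictAntiOn hurwitzNumber (Set.Icc (0 : ℚ) (1 / 2)) := by
  refine TreeVertex.strictAntiOn_of_vertex fun v hv => ?_
  simp only [hurwitzNumber]
  rw [hv.hurwitzPeriod_mediant, hv.hurwitzPeriod_frac.1, hv.hurwitzPeriod_frac.2]
  exact hv.periodicContFrac_lt

/-! ### Support lines -/

/-- The defect of the linear function `α q + β p` as a lower bound for `arcosh (3 m / 2)`. -/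
noncomputable def defect (α β : ℝ) (ξ : ℚ) : ℝ :=
  3 * (markovNumber ξ : ℝ) - 2 * Real.cosh (α * ξ.den + β * ξ.num)

lemma cosh_add_add_cosh_sub (a b : ℝ) :
    2 * Real.cosh (a + b) + 2 * Real.cosh (a - b) = (2 * Real.cosh a) * (2 * Real.cosh b) := by
  rw [Real.cosh_add, Real.cosh_sub]
  ring

/-- Here `d` and `d'` are the defects at the two ends of an edge. Subtracting a side defect from `z₁
z₂ - c₁ c₂` leaves a combination of both side defects with coefficients at least `1`. The symmetry
in `d`, `d'` lets the lemma work both down and up the tree. -/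
lemma le_new_defect {z₁ z₂ c₁ c₂ d d' : ℝ} (hz₁ : 2 ≤ z₁) (hz₂ : 2 ≤ z₂) (hc₁ : 2 ≤ c₁)
    (hc₂ : 2 ≤ c₂) (h₁ : 0 ≤ z₁ - c₁) (h₂ : 0 ≤ z₂ - c₂) (hsum : d + d' = z₁ * z₂ - c₁ * c₂)
    (hd : d ≤ z₁ - c₁ ∨ d ≤ z₂ - c₂) : z₁ - c₁ ≤ d' ∧ z₂ - c₂ ≤ d' := by
  rcases hd with hd | hd
  · have e : z₁ * z₂ - c₁ * c₂ - (z₁ - c₁) = (z₁ - c₁) * (z₂ - 1) + c₁ * (z₂ - c₂) := by ring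
    constructor <;> nlinarith [mul_nonneg h₁ (by linarith : 0 ≤ z₂ - 2),
      mul_nonneg h₂ (by linarith : 0 ≤ c₁ - 2)]
  · have e : z₁ * z₂ - c₁ * c₂ - (z₂ - c₂) = (z₂ - c₂) * (z₁ - 1) + c₂ * (z₁ - c₁) := by ring
    constructor <;> nlinarith [mul_nonneg h₂ (by linarith : 0 ≤ z₁ - 2),
      mul_nonneg h₁ (by linarith : 0 ≤ c₂ - 2)]

lemma exists_symmetric_cosh {x y z : ℝ} (hy : 0 < y) (hz : 0 < z) (hx : 2 < x)
    (h : y ^ 2 + z ^ 2 + x ^ 2 = x * y * z) :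
    ∃ u v, u + v = Real.arcosh (x / 2) ∧ y - 2 * Real.cosh u = z - 2 * Real.cosh v ∧
      0 ≤ y - 2 * Real.cosh u := by
  set s := Real.arcosh (x / 2) / 2 with hs
  have hspos : 0 < s := half_pos (Real.arcosh_pos (by linarith))
  have hS : 0 < Real.sinh s := Real.sinh_pos_iff.2 hspos
  have hC : 0 < Real.cosh s := Real.cosh_pos s
  have hCS : Real.cosh s ^ 2 = Real.sinh s ^ 2 + 1 := Real.cosh_sq s
  have hx2 : x = 4 * Real.sinh s ^ 2 + 2 := by
    have h2 : Real.cosh (2 * s) = x / 2 := by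
      rw [hs, mul_div_cancel₀ _ two_ne_zero, Real.cosh_arcosh (by linarith)]
    rw [Real.cosh_two_mul] at h2
    linarith
  -- With `u = s + t` and `v = s - t`, equality of the defects means `4 sinh s sinh t = y - z`.
  set t := Real.arsinh ((y - z) / (4 * Real.sinh s)) with ht
  have hD : 4 * Real.sinh s * Real.sinh t = y - z := by
    rw [ht, Real.sinh_arsinh]
    field_simp
  have hT : Real.cosh t ^ 2 = Real.sinh t ^ 2 + 1 := Real.cosh_sq t
  have heq : y - 2 * Real.cosh (s + t) = z - 2 * Real.cosh (s - t) := by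
    rw [Real.cosh_add, Real.cosh_sub]
    linarith
  -- The sum of the two equal defects is nonnegative: after multiplication by `sinh s` the squares
  -- differ by exactly `4`, the constant by which the Markov equation differs from the one for
  -- hyperbolic cosines.
  have hle : 4 * Real.cosh s * Real.cosh t ≤ y + z := by
    refine le_of_mul_le_mul_right ?_ hS
    refine abs_le_of_sq_le_sq' ?_ (by positivity) |>.2
    have e1 : (y + z) ^ 2 * Real.sinh s ^ 2 = (y - z) ^ 2 * Real.cosh s ^ 2 + x ^ 2 := by
      rw [hCS]
      linear_combination (-h) - y * z * hx2
    have e2 : (4 * Real.cosh s * Real.cosh t * Real.sinh s) ^ 2 =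
        (y - z) ^ 2 * Real.cosh s ^ 2 + (x ^ 2 - 4) := by
      rw [← hD, hx2]
      have : (4 * Real.cosh s * Real.cosh t * Real.sinh s) ^ 2 =
        16 * Real.cosh s ^ 2 * Real.cosh t ^ 2 * Real.sinh s ^ 2 := by ring
      rw [this, hT, hCS]
      ring
    rw [e2, mul_pow, e1]
    linarith
  refine ⟨s + t, s - t, by rw [hs]; ring, heq, ?_⟩
  have := cosh_add_add_cosh_sub s t
  linarith

namespace TreeVertex

variable {v : TreeVertex} {α β : ℝ}

lemma Below.two_le (h : root.Below v) : (2 : ℝ) ≤ 3 * (markovNumber v.lfrac : ℝ) ∧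
    (2 : ℝ) ≤ 3 * (markovNumber v.rfrac : ℝ) ∧ (2 : ℝ) < 3 * (markovNumber v.mediant : ℝ) := by
  have hg := good_root.below h
  rw [h.markovNumber_frac.1, h.markovNumber_frac.2, h.markovNumber_mediant]
  have h1 : (1 : ℝ) ≤ v.lmark := by exact_mod_cast hg.lmark_pos
  have h2 : (1 : ℝ) ≤ v.rmark := by exact_mod_cast hg.rmark_pos
  have h3 : (1 : ℝ) ≤ v.mark := by exact_mod_cast hg.mark_pos
  refine ⟨?_, ?_, ?_⟩ <;> linarith

lemma Good.linear_mediant (h : v.Good) (α β : ℝ) :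
    α * v.mediant.den + β * v.mediant.num =
      (α * v.lfrac.den + β * v.lfrac.num) + (α * v.rfrac.den + β * v.rfrac.num) := by
  rw [h.num_den_mediant.1, h.num_den_mediant.2, h.num_den_lfrac.1, h.num_den_lfrac.2,
    h.num_den_rfrac.1, h.num_den_rfrac.2]
  push_cast
  ring

lemma Below.defect_left (h : root.Below v) (α β : ℝ) :
    defect α β v.rfrac + defect α β v.left.mediant =
      (3 * (markovNumber v.lfrac : ℝ)) * (3 * (markovNumber v.mediant : ℝ)) -
      (2 * Real.cosh (α * v.lfrac.den + β * v.lfrac.num)) *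
        (2 * Real.cosh (α * v.mediant.den + β * v.mediant.num)) := by
  have hg := good_root.below h
  have h1 := hg.left.linear_mediant α β
  change _ = (α * v.lfrac.den + β * v.lfrac.num) +
    (α * v.mediant.den + β * v.mediant.num) at h1
  have h2 := hg.linear_mediant α β
  rw [mul_comm (2 * Real.cosh _), ← cosh_add_add_cosh_sub, defect, defect, h1,
    h.left.markovNumber_mediant, h.markovNumber_frac.1, h.markovNumber_frac.2,
    h.markovNumber_mediant, h2]
  simp only [TreeVertex.left]
  push_cast
  ring_nf

lemma Below.defect_right (h : root.Below v) (α β : ℝ) :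
    defect α β v.lfrac + defect α β v.right.mediant =
      (3 * (markovNumber v.mediant : ℝ)) * (3 * (markovNumber v.rfrac : ℝ)) -
      (2 * Real.cosh (α * v.mediant.den + β * v.mediant.num)) *
        (2 * Real.cosh (α * v.rfrac.den + β * v.rfrac.num)) := by
  have hg := good_root.below h
  have h1 := hg.right.linear_mediant α β
  change _ = (α * v.mediant.den + β * v.mediant.num) +
    (α * v.rfrac.den + β * v.rfrac.num) at h1
  have h2 := hg.linear_mediant α β
  rw [← cosh_add_add_cosh_sub, defect, defect, h1,
    h.right.markovNumber_mediant, h.markovNumber_frac.1, h.markovNumber_frac.2,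
    h.markovNumber_mediant, h2]
  simp only [TreeVertex.right]
  push_cast
  ring_nf

lemma two_le_two_mul_cosh (x : ℝ) : 2 ≤ 2 * Real.cosh x := by linarith [Real.one_le_cosh x]

lemma Below.le_defect_left (h : root.Below v) (hl : 0 ≤ defect α β v.lfrac)
    (hm : 0 ≤ defect α β v.mediant)
    (hr : defect α β v.rfrac ≤ defect α β v.lfrac ∨ defect α β v.rfrac ≤ defect α β v.mediant) :
    defect α β v.lfrac ≤ defect α β v.left.mediant ∧
      defect α β v.mediant ≤ defect α β v.left.mediant :=
  le_new_defect h.two_le.1 h.two_le.2.2.le (two_le_two_mul_cosh _) (two_le_two_mul_cosh _) hl hm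
    (h.defect_left α β) hr

lemma Below.le_defect_right (h : root.Below v) (hm : 0 ≤ defect α β v.mediant)
    (hr : 0 ≤ defect α β v.rfrac)
    (hl : defect α β v.lfrac ≤ defect α β v.mediant ∨ defect α β v.lfrac ≤ defect α β v.rfrac) :
    defect α β v.mediant ≤ defect α β v.right.mediant ∧
      defect α β v.rfrac ≤ defect α β v.right.mediant :=
  le_new_defect h.two_le.2.2.le h.two_le.2.1 (two_le_two_mul_cosh _) (two_le_two_mul_cosh _) hm hr
    (h.defect_right α β) hl

/-- The defect is nonnegative on the Farey triple of `v` and does not decrease downwards. -/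
structure Growing (α β : ℝ) (v : TreeVertex) : Prop where
  lnonneg : 0 ≤ defect α β v.lfrac
  rnonneg : 0 ≤ defect α β v.rfrac
  lle : defect α β v.lfrac ≤ defect α β v.mediant
  rle : defect α β v.rfrac ≤ defect α β v.mediant

lemma Growing.left (hv : root.Below v) (h : Growing α β v) : Growing α β v.left := by
  have hm := h.lnonneg.trans h.lle
  obtain ⟨h1, h2⟩ := hv.le_defect_left h.lnonneg hm (.inr h.rle)
  exact ⟨h.lnonneg, hm, h1, h2⟩

lemma Growing.right (hv : root.Below v) (h : Growing α β v) : Growing α β v.right := by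
  have hm := h.lnonneg.trans h.lle
  obtain ⟨h1, h2⟩ := hv.le_defect_right hm h.rnonneg (.inl h.lle)
  exact ⟨hm, h.rnonneg, h1, h2⟩

lemma Growing.below (hv : root.Below v) (h : Growing α β v) {w : TreeVertex} (hw : v.Below w) :
    Growing α β w := by
  induction hw with
  | refl => exact h
  | left hw ih => exact ih.left (hv.trans hw)
  | right hw ih => exact ih.right (hv.trans hw)

lemma Growing.nonneg (hv : root.Below v) (h : Growing α β v) {ξ : ℚ}
    (hξ : ξ ∈ Set.Ioo v.lfrac v.rfrac) : 0 ≤ defect α β ξ := by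
  obtain ⟨w, hw, rfl⟩ := (good_root.below hv).exists_below hξ
  have := h.below hv hw
  exact this.lnonneg.trans this.lle

/-- Climbing to the root: the inequality at the mediant makes the defect grow at each region met on
the way, and so also within every side branch. -/
lemma Below.defect_nonneg_outside (hv : root.Below v) (hl : 0 ≤ defect α β v.lfrac)
    (hr : 0 ≤ defect α β v.rfrac)
    (hm : defect α β v.mediant ≤ defect α β v.lfrac ∨ defect α β v.mediant ≤ defect α β v.rfrac)
    {ξ : ℚ} (hξ : ξ ∈ Set.Icc (0 : ℚ) (1 / 2)) (hout : ξ ∉ Set.Ioo v.lfrac v.rfrac) :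
    0 ≤ defect α β ξ := by
  induction hv with
  | refl =>
    rw [lfrac_root, rfrac_root] at *
    rcases hξ.1.eq_or_lt with rfl | h0
    · exact hl
    rcases hξ.2.eq_or_lt with rfl | h1
    · exact hr
    · exact absurd ⟨h0, h1⟩ hout
  | @left v hv ih =>
    change 0 ≤ defect α β v.lfrac at hl
    change 0 ≤ defect α β v.mediant at hr
    change _ ≤ defect α β v.lfrac ∨ _ ≤ defect α β v.mediant at hm
    -- The recursion read upwards: the mediant of the child is the old region, the right region of
    -- the parent the new one.
    obtain ⟨h1, h2⟩ := le_new_defect hv.two_le.1 hv.two_le.2.2.le (two_le_two_mul_cosh _)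
      (two_le_two_mul_cosh _) hl hr (by rw [add_comm]; exact hv.defect_left α β) hm
    change defect α β v.lfrac ≤ defect α β v.rfrac at h1
    change defect α β v.mediant ≤ defect α β v.rfrac at h2
    have hr' := hl.trans h1
    by_cases hin : ξ ∈ Set.Ioo v.lfrac v.rfrac
    · rcases lt_trichotomy ξ v.mediant with hlt | rfl | hgt
      · exact absurd ⟨hin.1, hlt⟩ hout
      · exact hr
      · obtain ⟨h3, h4⟩ := hv.le_defect_right hr hr' (.inr h1)
        exact Growing.nonneg hv.right ⟨hr, hr', h3, h4⟩ ⟨hgt, hin.2⟩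
    · exact ih hl hr' (.inr h2) hin
  | @right v hv ih =>
    change 0 ≤ defect α β v.mediant at hl
    change 0 ≤ defect α β v.rfrac at hr
    change _ ≤ defect α β v.mediant ∨ _ ≤ defect α β v.rfrac at hm
    obtain ⟨h1, h2⟩ := le_new_defect hv.two_le.2.2.le hv.two_le.2.1 (two_le_two_mul_cosh _)
      (two_le_two_mul_cosh _) hl hr (by rw [add_comm]; exact hv.defect_right α β) hm
    change defect α β v.mediant ≤ defect α β v.lfrac at h1
    change defect α β v.rfrac ≤ defect α β v.lfrac at h2
    have hl' := hr.trans h2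
    by_cases hin : ξ ∈ Set.Ioo v.lfrac v.rfrac
    · rcases lt_trichotomy ξ v.mediant with hlt | rfl | hgt
      · obtain ⟨h3, h4⟩ := hv.le_defect_left hl' hl (.inl h2)
        exact Growing.nonneg hv.left ⟨hl', hl, h3, h4⟩ ⟨hin.1, hlt⟩
      · exact hl
      · exact absurd ⟨hgt, hin.2⟩ hout
    · exact ih hl' hr (.inl h1) hin

lemma Good.exists_linear (h : v.Good) (a b : ℝ) : ∃ α β : ℝ,
    α * v.lfrac.den + β * v.lfrac.num = a ∧ α * v.rfrac.den + β * v.rfrac.num = b := by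
  have hdet : (v.rnum : ℝ) * v.lden = v.lnum * v.rden + 1 := by exact_mod_cast h.det
  refine ⟨a * v.rnum - b * v.lnum, b * v.lden - a * v.rden, ?_⟩
  rw [h.num_den_lfrac.1, h.num_den_lfrac.2, h.num_den_rfrac.1, h.num_den_rfrac.2]
  push_cast
  exact ⟨by linear_combination a * hdet, by linear_combination b * hdet⟩

lemma Below.exists_support (hv : root.Below v) : ∃ α β : ℝ,
    α * v.mediant.den + β * v.mediant.num =
      Real.arcosh (3 * (markovNumber v.mediant : ℝ) / 2) ∧
    ∀ ξ ∈ Set.Icc (0 : ℚ) (1 / 2), 0 ≤ defect α β ξ := by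
  have hg := good_root.below hv
  obtain ⟨hl2, hr2, hm2⟩ := hv.two_le
  have hmarkov : (v.lmark : ℝ) ^ 2 + v.rmark ^ 2 + v.mark ^ 2 =
      3 * v.lmark * v.rmark * v.mark := by exact_mod_cast hg.markov
  obtain ⟨a, b, hab, heq, hnn⟩ := exists_symmetric_cosh (by linarith) (by linarith) hm2
    (y := 3 * (markovNumber v.lfrac : ℝ)) (z := 3 * (markovNumber v.rfrac : ℝ)) (by
      rw [hv.markovNumber_frac.1, hv.markovNumber_frac.2, hv.markovNumber_mediant]
      linear_combination 9 * hmarkov)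
  obtain ⟨α, β, rfl, rfl⟩ := hg.exists_linear a b
  rw [← hg.linear_mediant] at hab
  refine ⟨α, β, hab, ?_⟩
  have hm : defect α β v.mediant = 0 := by
    rw [defect, hab, Real.cosh_arcosh (by linarith)]
    ring
  have hl : 0 ≤ defect α β v.lfrac := hnn
  have hlr : defect α β v.lfrac = defect α β v.rfrac := heq
  have hr : 0 ≤ defect α β v.rfrac := hlr ▸ hl
  intro ξ hξ
  by_cases hin : ξ ∈ Set.Ioo v.lfrac v.rfrac
  · rcases lt_trichotomy ξ v.mediant with hlt | rfl | hgt
    · obtain ⟨h1, h2⟩ := hv.le_defect_left hl hm.ge (.inl hlr.ge)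
      exact Growing.nonneg hv.left ⟨hl, hm.ge, h1, h2⟩ ⟨hin.1, hlt⟩
    · exact hm.ge
    · obtain ⟨h1, h2⟩ := hv.le_defect_right hm.ge hr (.inr hlr.le)
      exact Growing.nonneg hv.right ⟨hm.ge, hr, h1, h2⟩ ⟨hgt, hin.2⟩
  · exact hv.defect_nonneg_outside hl hr (.inl (hm.le.trans hl)) hξ hin

lemma defect_root (α β : ℝ) : defect α β root.lfrac = 3 - 2 * Real.cosh α ∧
    defect α β root.rfrac = 6 - 2 * Real.cosh (2 * α + β) ∧
    defect α β root.mediant = 15 - 2 * Real.cosh (3 * α + β) := by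
  have hb : root.Below root := .refl
  have hg := good_root
  rw [defect, defect, defect, hb.markovNumber_frac.1, hb.markovNumber_frac.2,
    hb.markovNumber_mediant, hg.num_den_mediant.1, hg.num_den_mediant.2, hg.num_den_lfrac.1,
    hg.num_den_lfrac.2, hg.num_den_rfrac.1, hg.num_den_rfrac.2]
  simp only [root]
  norm_num [mul_comm]

lemma Growing.nonneg_Icc (h : Growing α β root) {ξ : ℚ} (hξ : ξ ∈ Set.Icc (0 : ℚ) (1 / 2)) :
    0 ≤ defect α β ξ := by
  by_cases hin : ξ ∈ Set.Ioo root.lfrac root.rfrac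
  · exact h.nonneg .refl hin
  · rw [lfrac_root, rfrac_root] at hin
    rcases hξ.1.eq_or_lt with rfl | h0
    · simpa [lfrac_root] using h.lnonneg
    rcases hξ.2.eq_or_lt with rfl | h1
    · simpa [rfrac_root] using h.rnonneg
    · exact absurd ⟨h0, h1⟩ hin

lemma exists_growing_zero : ∃ α β : ℝ, α = Real.arcosh (3 / 2) ∧ Growing α β root := by
  -- This slope makes the linear form vanish at `1/2`; the defects at `0`, `1/2`, `1/3` are then
  -- `0`, `4`, `12`.
  refine ⟨_, -2 * Real.arcosh (3 / 2), rfl, ?_⟩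
  have hc : Real.cosh (Real.arcosh (3 / 2)) = 3 / 2 := Real.cosh_arcosh (by norm_num)
  set a := Real.arcosh (3 / 2)
  obtain ⟨h1, h2, h3⟩ := defect_root a (-2 * a)
  have e2 : 2 * a + -2 * a = 0 := by ring
  have e3 : 3 * a + -2 * a = a := by ring
  rw [hc] at h1
  rw [e2, Real.cosh_zero] at h2
  rw [e3, hc] at h3
  constructor <;> simp only [h1, h2, h3] <;> norm_num

/-- The horizontal support at `1/2`: here `cosh² = 2`, and the defects at `0`, `1/2`, `1/3` are `3 -
2√2`, `0`, `15 - 10√2`. -/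
lemma growing_half : Growing (Real.arcosh 3 / 2) 0 root ∧
    0 < defect (Real.arcosh 3 / 2) 0 root.lfrac := by
  have hc : Real.cosh (2 * (Real.arcosh 3 / 2)) = 3 := by
    rw [mul_div_cancel₀ _ two_ne_zero, Real.cosh_arcosh (by norm_num)]
  set a := Real.arcosh 3 / 2
  obtain ⟨h1, h2, h3⟩ := defect_root a 0
  have h4 := Real.cosh_three_mul a
  rw [add_zero] at h2 h3
  have h5 : Real.cosh a ^ 2 = 2 := by
    have h6 := Real.cosh_two_mul a
    have h7 := Real.cosh_sq a
    linarith
  have h6 : Real.cosh a < 3 / 2 := by nlinarith [Real.cosh_pos a]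
  have h8 : Real.cosh (3 * a) = 5 * Real.cosh a := by
    rw [h4]
    linear_combination 4 * Real.cosh a * h5
  rw [hc] at h2
  rw [h8] at h3
  refine ⟨⟨?_, ?_, ?_, ?_⟩, ?_⟩ <;> simp only [h1, h2, h3] <;> linarith

/-- The defect vanishes at `1/2`, so strictness is carried along left fractions only, none of which
is `1/2`. -/
lemma defect_half_pos {ξ : ℚ} (hξ : ξ ∈ Set.Icc (0 : ℚ) (1 / 2)) (hne : ξ ≠ 1 / 2) :
    0 < defect (Real.arcosh 3 / 2) 0 ξ := by
  obtain ⟨hgr, hpos⟩ := growing_half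
  have key : ∀ v, root.Below v → 0 < defect (Real.arcosh 3 / 2) 0 v.lfrac := fun v hv => by
    induction hv with
    | refl => exact hpos
    | left _ ih => exact ih
    | right hv ih => exact ih.trans_le (hgr.below .refl hv).lle
  rcases eq_zero_or_eq_half_or_exists_mediant hξ with rfl | rfl | ⟨v, hv, rfl⟩
  · simpa [lfrac_root] using hpos
  · exact absurd rfl hne
  · exact (key v hv).trans_le (hgr.below .refl hv).lle

end TreeVertex

/-! ### From support lines to convexity and monotonicity of the exponent. -/

lemma linear_le_arcosh {α β : ℝ} {ξ : ℚ} (h : 0 ≤ defect α β ξ) :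
    α * ξ.den + β * ξ.num ≤ Real.arcosh (3 * (markovNumber ξ : ℝ) / 2) := by
  rw [defect] at h
  have hc := Real.one_le_cosh (α * ξ.den + β * ξ.num)
  calc _ ≤ |α * ξ.den + β * ξ.num| := le_abs_self _
    _ = Real.arcosh (Real.cosh |α * ξ.den + β * ξ.num|) := (Real.arcosh_cosh (abs_nonneg _)).symm
    _ ≤ _ := by
      rw [Real.cosh_abs]
      exact (Real.arcosh_le_arcosh (by linarith) (by linarith)).2 (by linarith)

lemma linear_lt_arcosh {α β : ℝ} {ξ : ℚ} (h : 0 < defect α β ξ) :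
    α * ξ.den + β * ξ.num < Real.arcosh (3 * (markovNumber ξ : ℝ) / 2) := by
  rw [defect] at h
  have hc := Real.one_le_cosh (α * ξ.den + β * ξ.num)
  calc _ ≤ |α * ξ.den + β * ξ.num| := le_abs_self _
    _ = Real.arcosh (Real.cosh |α * ξ.den + β * ξ.num|) := (Real.arcosh_cosh (abs_nonneg _)).symm
    _ < _ := by
      rw [Real.cosh_abs]
      exact (Real.arcosh_lt_arcosh (by linarith) (by linarith)).2 (by linarith)

/-- The Lyapunov exponent of a Markov–Hurwitz number as a function of its Farey parameter. -/
noncomputable def exponent (ξ : ℚ) : ℝ :=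
  1 / (2 * (ξ.den : ℝ)) * Real.arcosh (3 * (markovNumber ξ : ℝ) / 2)

lemma linear_eq (α β : ℝ) (ξ : ℚ) :
    1 / (2 * (ξ.den : ℝ)) * (α * ξ.den + β * ξ.num) = α / 2 + β / 2 * ξ := by
  have hd : (ξ.den : ℝ) ≠ 0 := by exact_mod_cast ξ.den_ne_zero
  have h : (ξ : ℝ) = ξ.num / ξ.den := by exact_mod_cast (Rat.num_div_den ξ).symm
  rw [h]
  field_simp

lemma exists_affine_support {ξ : ℚ} (hξ : ξ ∈ Set.Icc (0 : ℚ) (1 / 2)) :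
    ∃ a b : ℝ, a + b * ξ = exponent ξ ∧
      ∀ η ∈ Set.Icc (0 : ℚ) (1 / 2), a + b * η ≤ exponent η := by
  suffices H : ∃ α β : ℝ,
      α * ξ.den + β * ξ.num = Real.arcosh (3 * (markovNumber ξ : ℝ) / 2) ∧
      ∀ η ∈ Set.Icc (0 : ℚ) (1 / 2), 0 ≤ defect α β η by
    obtain ⟨α, β, h1, h2⟩ := H
    refine ⟨α / 2, β / 2, by rw [← linear_eq, h1, exponent], fun η hη => ?_⟩
    rw [← linear_eq, exponent]
    exact mul_le_mul_of_nonneg_left (linear_le_arcosh (h2 η hη)) (by positivity)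
  rcases TreeVertex.eq_zero_or_eq_half_or_exists_mediant hξ with rfl | rfl | ⟨v, hv, rfl⟩
  · obtain ⟨α, β, h1, h2⟩ := TreeVertex.exists_growing_zero
    exact ⟨α, β, by simp [h1, markovNumber], fun η hη => h2.nonneg_Icc hη⟩
  · refine ⟨_, _, ?_, fun η hη => TreeVertex.growing_half.1.nonneg_Icc hη⟩
    have : (1 / 2 : ℚ).den = 2 := by norm_num
    rw [this]
    norm_num [markovNumber]
  · exact hv.exists_support

lemma exponent_half_lt {ξ : ℚ} (hξ : ξ ∈ Set.Icc (0 : ℚ) (1 / 2)) (hne : ξ ≠ 1 / 2) :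
    exponent (1 / 2) < exponent ξ := by
  have h := linear_lt_arcosh (TreeVertex.defect_half_pos hξ hne)
  have hd : (0 : ℝ) < ξ.den := by exact_mod_cast ξ.den_pos
  have h' := mul_lt_mul_of_pos_left h (by positivity : 0 < 1 / (2 * (ξ.den : ℝ)))
  rw [linear_eq] at h'
  refine lt_of_eq_of_lt ?_ h'
  have : (1 / 2 : ℚ).den = 2 := by norm_num
  rw [exponent, this]
  norm_num [markovNumber]
  ring

lemma exponent_strictAntiOn : StrictAntiOn exponent (Set.Icc (0 : ℚ) (1 / 2)) := by
  intro s hs t ht hst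
  rcases ht.2.eq_or_lt with rfl | htlt
  · exact exponent_half_lt hs hst.ne
  obtain ⟨a, b, h1, h2⟩ := exists_affine_support ht
  have hhalf : (1 / 2 : ℚ) ∈ Set.Icc (0 : ℚ) (1 / 2) := by norm_num
  have h3 := h2 s hs
  have h4 := h2 _ hhalf
  have h5 := exponent_half_lt ht htlt.ne
  have e1 : (s : ℝ) < t := by exact_mod_cast hst
  have e2 : (t : ℝ) < ((1 / 2 : ℚ) : ℝ) := by exact_mod_cast htlt
  by_contra! hle
  -- If the exponent did not drop from `s` to `t`, the support line at `t` would not descend,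
  -- contradicting the smaller value at `1/2`.
  have hb : 0 ≤ b := by
    by_contra! hb
    nlinarith
  nlinarith

lemma convexOn_exponent : ConvexOn ℚ (Set.Icc (0 : ℚ) (1 / 2)) exponent := by
  refine ⟨convex_Icc _ _, fun s hs t ht x y hx hy hxy => ?_⟩
  obtain ⟨a, b, h1, h2⟩ := exists_affine_support ((convex_Icc _ _) hs ht hx hy hxy)
  rw [← h1]
  have hx' : (0 : ℝ) ≤ x := by exact_mod_cast hx
  have hy' : (0 : ℝ) ≤ y := by exact_mod_cast hy
  have hxy' : (x : ℝ) + y = 1 := by exact_mod_cast hxy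
  have e1 := mul_le_mul_of_nonneg_left (h2 s hs) hx'
  have e2 := mul_le_mul_of_nonneg_left (h2 t ht) hy'
  simp only [Rat.smul_def, smul_eq_mul]
  push_cast
  have : a = a * (x + y) := by rw [hxy', mul_one]
  linarith

end MarkovHurwitz

theorem theorem2 :
    (∀ ξ ∈ Set.Icc (0 : ℚ) (1 / 2),
      MarkovHurwitz.lyapunov (MarkovHurwitz.hurwitzNumber ξ) =
          1 / (2 * (ξ.den : ℝ)) * Real.arcosh (3 * (MarkovHurwitz.markovNumber ξ : ℝ) / 2) ∧
        MarkovHurwitz.lyapunov (MarkovHurwitz.hurwitzNumber ξ) =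
          1 / 2 * MarkovHurwitz.fock ξ) ∧
    ConvexOn ℚ (Set.Icc (0 : ℚ) (1 / 2))
      (fun ξ : ℚ => MarkovHurwitz.lyapunov (MarkovHurwitz.hurwitzNumber ξ)) ∧
    StrictMonoOn MarkovHurwitz.lyapunov MarkovHurwitz.hurwitzSet ∧
    MarkovHurwitz.hurwitzNumber (1 / 2) = √2 - 1 ∧
    IsLeast MarkovHurwitz.hurwitzSet (√2 - 1) ∧
    MarkovHurwitz.lyapunov (√2 - 1) = 1 / 2 * Real.log (1 + √2) ∧
    MarkovHurwitz.hurwitzNumber 0 = (√5 - 1) / 2 ∧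
    IsGreatest MarkovHurwitz.hurwitzSet ((√5 - 1) / 2) ∧
    MarkovHurwitz.lyapunov ((√5 - 1) / 2) = Real.log ((1 + √5) / 2) := by
  open MarkovHurwitz in
  have h0 : (0 : ℚ) ∈ Set.Icc (0 : ℚ) (1 / 2) := by norm_num
  have h1 : (1 / 2 : ℚ) ∈ Set.Icc (0 : ℚ) (1 / 2) := by norm_num
  have hanti := hurwitzNumber_strictAntiOn
  refine ⟨fun ξ hξ => ⟨lyapunov_hurwitzNumber hξ, ?_⟩, ?_, ?_, hurwitzNumber_half, ⟨?_, ?_⟩, ?_,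
    hurwitzNumber_zero, ⟨?_, ?_⟩, ?_⟩
  · rw [lyapunov_hurwitzNumber hξ, fock, mul_div_right_comm, one_div, one_div, mul_inv]
    ring
  · exact convexOn_exponent.congr fun ξ hξ => (lyapunov_hurwitzNumber hξ).symm
  · rintro _ ⟨ξ, hξ, rfl⟩ _ ⟨η, hη, rfl⟩ hlt
    rw [lyapunov_hurwitzNumber hξ, lyapunov_hurwitzNumber hη]
    exact exponent_strictAntiOn hη hξ ((hanti.lt_iff_gt hξ hη).1 hlt)
  · exact ⟨_, h1, hurwitzNumber_half⟩
  · rintro _ ⟨ξ, hξ, rfl⟩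
    rw [← hurwitzNumber_half]
    exact (hanti.le_iff_ge h1 hξ).2 hξ.2
  · have hden : (1 / 2 : ℚ).den = 2 := by norm_num
    have hm : markovNumber (1 / 2) = 2 := by norm_num [markovNumber]
    have hcosh : Real.cosh (2 * Real.log (1 + √2)) = 3 * ((2 : ℤ) : ℝ) / 2 := by
      have hs : √2 ^ 2 = 2 := Real.sq_sqrt (by norm_num)
      rw [Real.cosh_two_mul, Real.sinh_sq, Real.cosh_log (by positivity)]
      field_simp
      push_cast
      nlinarith [Real.sqrt_nonneg 2]
    have hlog : 0 ≤ Real.log (1 + √2) := Real.log_nonneg (by linarith [Real.sqrt_nonneg 2])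
    rw [← hurwitzNumber_half, lyapunov_hurwitzNumber h1, hden, hm, ← hcosh,
      Real.arcosh_cosh (by positivity)]
    push_cast
    ring
  · exact ⟨_, h0, hurwitzNumber_zero⟩
  · rintro _ ⟨ξ, hξ, rfl⟩
    rw [← hurwitzNumber_zero]
    exact (hanti.le_iff_ge hξ h0).2 hξ.1
  · have hm : markovNumber 0 = 1 := by norm_num [markovNumber]
    have hs : √5 ^ 2 = 5 := Real.sq_sqrt (by norm_num)
    have hcosh : Real.cosh (2 * Real.log ((1 + √5) / 2)) = 3 * ((1 : ℤ) : ℝ) / 2 := by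
      rw [Real.cosh_two_mul, Real.sinh_sq, Real.cosh_log (by positivity)]
      field_simp
      push_cast
      nlinarith [Real.sqrt_nonneg 5]
    have h5 : 1 ≤ √5 := Real.one_le_sqrt.2 (by norm_num)
    have hlog : 0 ≤ Real.log ((1 + √5) / 2) := Real.log_nonneg (by linarith)
    rw [← hurwitzNumber_zero, lyapunov_hurwitzNumber h0, hm, ← hcosh,
      Real.arcosh_cosh (by positivity)]
    simp
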